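/- **Theorem 3.3.** Let $\tilde\alpha\colon S^2\times\mathbb R^3\to\mathbb R^3$ be continuous, let $b\in\mathbb R^3$, $b\neq 0$, be the Burgers vector, and put $\hat b=b/|b|$. *Definitions.* Let $\Omega\subseteq\mathbb R^3$ be open. A (vector valued) dislocation measure on $\Omega$ is a measure $\rho=\tau|\rho|$, where $|\rho|$ is a nonnegative Radon measure on $\Omega$, $\tau$ is a continuous field of unit vectors on $\operatorname{supp}|\rho|$, and $\rho=\operatorname{rot}h$ in the sense of distributions for some $h\in L^1_{\rm loc}(\Omega,\mathbb R^3)$. For a symmetric-matrix valued field $T$, continuous on $\overline\Omega$, and a dislocation measure $\rho=\tau|\rho|$ put $$\alpha[T,\rho,b]=\tilde\alpha(\tau,\tau\times Tb)\times\tau\,|\rho| ;$$ the same formula defines $\alpha[T,\rho,b]\in\mathbb R^3$ for a symmetric matrix $T$ and a vector $\rho\in\mathbb R^3$, where $\tau=\rho/|\rho|$ and $\alpha[T,0,b]=0$. Let $T_e>0$. A moving $C^1$ curve in $\Omega$ is a family of sets $\ell(t)\subseteq\Omega$, $t\in[0,T_e)$, with unit tangent vectors $\tau(x,t)$, $x\in\ell(t)$,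 such that $\{(t,x): x\in\ell(t)\}$ is relatively closed in $[0,T_e)\times\Omega$ and near each of its points the sets $\ell(t)$ have injective regular parametrizations $s\mapsto Y(t,s)$, jointly $C^1$ in $(t,s)$ (up to $t=0$), with $\tau=\partial_sY/|\partial_sY|$. (Closed curves are included, and so are curves that leave every compact subset of $\Omega$; $\ell(t)$ need not be connected.) Its dislocation measure is $\rho_{\ell(t)}=\tau\,|\rho_{\ell(t)}|$ with $|\rho_{\ell(t)}|=|b|\,\mathcal H^1\lfloor\ell(t)$, that is, $\langle\rho_{\ell(t)},\varphi\rangle=|b|\int_{\ell(t)}\tau\cdot\varphi\,ds$. The normal velocity $v(x_0,t_0)$ at $x_0\in\ell(t_0)$ is $x'(t_0)$ (one-sided if $t_0=0$), where, for $t$ near $t_0$, $x(t)$ is the unique point near $x_0$ in which $\ell(t)$ meets the plane through $x_0$ orthogonal to $\tau(x_0,t_0)$. By $\operatorname{proj}_\tau$ we denote the orthogonal projection of $\mathbb R^3$ onto $\{\xi:\xi\cdot\tau=0\}$. **(i)** If $\xi\cdot\tilde\alpha(\tau,\xi)\ge 0$ for all $(\tau,\xi)\in S^2\times\mathbb R^3$,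 then $(T\hat b)\cdot\alpha[T,\rho,b]\ge 0$ for every symmetric matrix $T\in\mathbb R^{3\times 3}$ and every $\rho\in\mathbb R^3$; likewise, for every open $\Omega$, every continuous symmetric-matrix valued $T$ on $\overline\Omega$ and every dislocation measure $\rho$ on $\Omega$, the measure $(T\hat b)\cdot\alpha[T,\rho,b]$ on $\Omega$ is nonnegative. **(ii)** Let $T$ be a continuous symmetric-matrix valued function on $[0,T_e]\times\overline\Omega$, and let $\ell(t)$, $t\in[0,T_e)$, be a moving $C^1$ curve in $\Omega$ such that $\rho_{\ell(t)}$ is a dislocation measure on $\Omega$ for every $t$. Then $\rho=\rho_{\ell(t)}$ is a weak solution of $$\partial_t\rho=\operatorname{rot}\bigl(\tilde\alpha(\tau,\tau\times Tb)\times\rho\bigr),$$ that is, for all $\varphi\in C_0^\infty((0,T_e)\times\Omega,\mathbb R^3)$ the following integrals exist and satisfy $$-\int_0^{T_e}\langle\rho(t),\partial_t\varphi(t)\rangle\,dt=\int_0^{T_e}\bigl\langle\tilde\alpha(\tau,\tau\times Tb)\times\rho(t),\operatorname{rot}\varphi(t)\bigr\rangle\,dt,$$ if and only if, for every $t\in[0,T_e)$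 and every $x\in\ell(t)$, the normal velocity exists and is $$v(x,t)=\operatorname{proj}_{\tau(x,t)}\tilde\alpha\bigl(\tau(x,t),F(x,t)\bigr),\qquad F(x,t)=\tau(x,t)\times T(x,t)b ,$$ $F$ being the Peach–Koehler force. -/

import Mathlib

open Set Filter Topology MeasureTheory
open scoped ContDiff

namespace Dislocation

noncomputable section

/-- Euclidean three-space. -/
abbrev E3 : Type := EuclideanSpace ℝ (Fin 3)

/-- The cross product on `E3`. -/
def cross (u w : E3) : E3 := WithLp.toLp 2 (crossProduct u.ofLp w.ofLp)

/-- The matrix-vector product `A u` on `E3`. -/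
def app (A : Matrix (Fin 3) (Fin 3) ℝ) (u : E3) : E3 := WithLp.toLp 2 (A.mulVec u.ofLp)

/-- The partial derivative `∂ᵢ φⱼ` at `x`. -/
def partialDeriv (φ : E3 → E3) (i j : Fin 3) (x : E3) : ℝ :=
  (fderiv ℝ φ x (EuclideanSpace.single i 1)) j

/-- The rotation (curl) of a vector field. -/
def rot (φ : E3 → E3) (x : E3) : E3 :=
  !₂[partialDeriv φ 1 2 x - partialDeriv φ 2 1 x,
     partialDeriv φ 2 0 x - partialDeriv φ 0 2 x,
     partialDeriv φ 0 1 x - partialDeriv φ 1 0 x]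

/-- The duality bracket `⟨βμ, φ⟩ = ∫ β · φ dμ` of the vector valued measure `βμ` with `φ`. -/
def pairing (μ : Measure E3) (β φ : E3 → E3) : ℝ := ∫ x, inner ℝ (β x) (φ x) ∂μ

/-- `τμ` is a vector valued dislocation measure on `Ω`: `μ` is a nonnegative Radon measure on `Ω`
(extended by zero to the whole space), `τ` is a continuous field of unit vectors on the support of
`μ` in `Ω` (its values elsewhere are irrelevant), and `τμ = rot h` in the sense of distributions
on `Ω` for some locally integrable `h`. -/
structure IsDislocationMeasure (Ω : Set E3) (μ : Measure E3) (τ : E3 → E3) : Prop where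
  compl_null : μ Ωᶜ = 0
  finite_on_compacts : ∀ K ⊆ Ω, IsCompact K → μ K < ⊤
  continuousOn_tangent : ContinuousOn τ (μ.support ∩ Ω)
  norm_tangent : ∀ x ∈ μ.support ∩ Ω, ‖τ x‖ = 1
  eq_rot : ∃ h : E3 → E3, LocallyIntegrableOn h Ω volume ∧
    ∀ φ : E3 → E3, ContDiff ℝ ∞ φ → HasCompactSupport φ → tsupport φ ⊆ Ω →
      pairing μ τ φ = ∫ x in Ω, inner ℝ (h x) (rot φ x)

/-- The function `α[T, ρ, b] = α̃(τ, τ × Tb) × τ |ρ|` at a point `(T, ρ)`, where `ρ = τ |ρ|` is a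
vector (and the value is `0` if `ρ = 0`). -/
def alphaPoint (αt : E3 → E3 → E3) (T : Matrix (Fin 3) (Fin 3) ℝ) (ρ b : E3) : E3 :=
  ‖ρ‖ • cross (αt (‖ρ‖⁻¹ • ρ) (cross (‖ρ‖⁻¹ • ρ) (app T b))) (‖ρ‖⁻¹ • ρ)

/-- The vector field `α̃(τ, τ × Tb) × τ`. It is the density with respect to `μ = |ρ|` of the measure
`α[T, ρ, b] = α̃(τ, τ × Tb) × τ |ρ|` for a dislocation measure `ρ = τμ`. -/
def alphaDensity (αt : E3 → E3 → E3) (T : E3 → Matrix (Fin 3) (Fin 3) ℝ) (τ : E3 → E3) (b : E3)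
    (x : E3) : E3 :=
  cross (αt (τ x) (cross (τ x) (app (T x) b))) (τ x)

/-- `ρ(t) = τ(t) μ(t)` is a (weak) solution of `∂ₜ ρ = rot (α̃(τ, τ × Tb) × ρ)` on `(0, Te) × Ω`:
for every smooth test field with compact support in `(0, Te) × Ω` both time integrals exist, and
`- ∫ ⟨ρ, ∂ₜ φ⟩ dt = ∫ ⟨α̃(τ, τ × Tb) × ρ, rot φ⟩ dt`. -/
def IsWeakSolution (Ω : Set E3) (Te : ℝ) (αt : E3 → E3 → E3)
    (T : ℝ → E3 → Matrix (Fin 3) (Fin 3) ℝ) (b : E3)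
    (μ : ℝ → Measure E3) (τ : ℝ → E3 → E3) : Prop :=
  ∀ φ : ℝ × E3 → E3, ContDiff ℝ ∞ φ → HasCompactSupport φ → tsupport φ ⊆ Ioo 0 Te ×ˢ Ω →
    IntegrableOn (fun t => pairing (μ t) (τ t) (fun x => deriv (fun s => φ (s, x)) t))
      (Ioo 0 Te) volume ∧
    IntegrableOn (fun t => pairing (μ t) (alphaDensity αt (T t) (τ t) b)
      (rot (fun x => φ (t, x)))) (Ioo 0 Te) volume ∧
    - ∫ t in Ioo 0 Te, pairing (μ t) (τ t) (fun x => deriv (fun s => φ (s, x)) t) =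
      ∫ t in Ioo 0 Te, pairing (μ t) (alphaDensity αt (T t) (τ t) b) (rot (fun x => φ (t, x)))

/-- The total variation `|ρ_ℓ| = |b| ℋ¹⌊ℓ` of the dislocation measure `ρ_ℓ = τ |ρ_ℓ|` of the curve
`ℓ` with Burgers vector `b`, so that `⟨ρ_ℓ, φ⟩ = |b| ∫_ℓ τ · φ ds`. -/
def curveMeasure (b : E3) (ℓ : Set E3) : Measure E3 :=
  ENNReal.ofReal ‖b‖ • (Measure.hausdorffMeasure 1 : Measure E3).restrict ℓ

/-- `ℓ(t)`, `0 ≤ t < Te`, is a moving `C¹` curve in `Ω` with unit tangent field `τ(t)`: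
the set `{(t, x) | x ∈ ℓ(t)}` is relatively closed in `[0, Te) × Ω`, and near each of its points
`(t₀, x₀)` the curves are the images of regular injective parametrizations `s ↦ Y(t, s)`, jointly
`C¹` in `(t, s)`, whose normalized derivative in `s` is `τ`. Closed curves are included,
and so are curves that leave every compact subset of `Ω`, such as straight lines in space.
(As only the values of `Y` near `(t₀, 0)` with `t ∈ [0, Te)` matter, taking `Y` to be defined and
`C¹` on the whole plane is no restriction.) -/
structure IsMovingCurve (Ω : Set E3) (Te : ℝ) (ℓ : ℝ → Set E3) (τ : ℝ → E3 → E3) : Prop where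
  subset : ∀ t ∈ Ico 0 Te, ℓ t ⊆ Ω
  relClosed : closure {p : ℝ × E3 | p.1 ∈ Ico 0 Te ∧ p.2 ∈ ℓ p.1} ∩ Ico 0 Te ×ˢ Ω ⊆
    {p : ℝ × E3 | p.1 ∈ Ico 0 Te ∧ p.2 ∈ ℓ p.1}
  exists_chart : ∀ t₀ ∈ Ico 0 Te, ∀ x₀ ∈ ℓ t₀,
    ∃ Y : ℝ × ℝ → E3, ∃ δ > 0, ∃ r > 0, ∃ U ∈ 𝓝 x₀, ContDiff ℝ 1 Y ∧ Y (t₀, 0) = x₀ ∧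
      ∀ t ∈ Ico 0 Te, |t - t₀| < δ →
        InjOn (fun s => Y (t, s)) (Icc (-r) r) ∧
        ℓ t ∩ U = (fun s => Y (t, s)) '' Icc (-r) r ∩ U ∧
        ∀ s ∈ Icc (-r) r,
          deriv (fun σ => Y (t, σ)) s ≠ 0 ∧
          (Y (t, s) ∈ U → τ t (Y (t, s)) =
            ‖deriv (fun σ => Y (t, σ)) s‖⁻¹ • deriv (fun σ => Y (t, σ)) s)

/-- `v` is the normal velocity at time `t₀` of the moving curve `ℓ` at `x₀ ∈ ℓ(t₀)`: for `t` near
`t₀` the curve `ℓ(t)` meets the plane through `x₀` orthogonal to `τ(t₀, x₀)` in exactly one point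
`x(t)` near `x₀`, and `x'(t₀) = v` (a one-sided derivative if `t₀ = 0`). -/
def HasNormalVelocity (Te : ℝ) (ℓ : ℝ → Set E3) (τ : ℝ → E3 → E3) (t₀ : ℝ) (x₀ v : E3) : Prop :=
  ∃ x : ℝ → E3, x t₀ = x₀ ∧
    (∃ U ∈ 𝓝 x₀, ∀ᶠ t in 𝓝[Ico 0 Te] t₀,
      ℓ t ∩ {z | inner ℝ (z - x₀) (τ t₀ x₀) = 0} ∩ U = {x t}) ∧
    HasDerivWithinAt x v (Ico 0 Te) t₀

/-- The orthogonal projection onto the orthogonal complement of `τ`. -/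
def projPerp (τ w : E3) : E3 := (Submodule.span ℝ {τ})ᗮ.starProjection w

end

end Dislocation

open Dislocation

namespace Dislocation

/-! ### Vector algebra -/

/-! Part (i) is the cyclic identity Tb · (α̃ × τ) = (τ × Tb) · α̃: up to the factor 1/|b|, the
density is the product of force and α̃ that is assumed nonnegative.

Part (ii) is local. Parametrize a piece of the curve by Y(t, s), and let φ be a test field supported
near it. For ψ(t, s) = φ(t, Y(t, s)), the integral of ∂ₛY · ∂ₜψ - ∂ₜY · ∂ₛψ vanishes
(`integral_inner_fderiv_sub_eq_zero`). By the chain rule this says ∂ₜρ = rot (∂ₜY × ρ), whatever the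
motion (`IsChart.integral_transport_eq_zero`). Subtracting the weak equation leaves -|b| ∫∫ rot φ ·
m dt ds with m = (∂ₜY - α̃) × ∂ₛY, the `defect` (`IsChart.weak_residual`). Passing from ℋ¹ on the
curve to ds is the length formula `lintegral_norm_deriv_eq_hausdorffMeasure_image`.

By the implicit function theorem the normal velocity always exists and is the normal part of ∂ₜY
(`IsChart.hasNormalVelocity`). Hence m = 0 exactly where it equals the normal part of α̃, and it
remains to compare the weak equation with m = 0.

If m = 0, every test field supported in a chart satisfies the weak equation, and a partition of
unity gives all of them (`isWeakSolution_of_forall_defect_eq_zero`). Conversely, if m ≠ 0 at some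
positive time, an explicit test field whose rotation on the curve is a nonnegative multiple of that
value of m, apart from terms that m does not see, makes the residual nonzero
(`IsChart.defect_eq_zero`). Time 0 follows by continuity. -/

theorem cross_apply_zero (u w : E3) : cross u w 0 = u 1 * w 2 - u 2 * w 1 := by
  simp [cross, crossProduct]

theorem cross_apply_one (u w : E3) : cross u w 1 = u 2 * w 0 - u 0 * w 2 := by
  simp [cross, crossProduct]

theorem cross_apply_two (u w : E3) : cross u w 2 = u 0 * w 1 - u 1 * w 0 := by
  simp [cross, crossProduct]

theorem inner_eq_sum (u w : E3) : inner ℝ u w = u 0 * w 0 + u 1 * w 1 + u 2 * w 2 := by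
  simp [PiLp.inner_apply, Fin.sum_univ_three, mul_comm]

theorem E3.ext_coord {u w : E3} (h0 : u 0 = w 0) (h1 : u 1 = w 1) (h2 : u 2 = w 2) : u = w := by
  ext i; fin_cases i <;> assumption

theorem inner_cross_rotate (u v w : E3) : inner ℝ u (cross v w) = inner ℝ (cross w u) v := by
  simp only [inner_eq_sum, cross_apply_zero, cross_apply_one, cross_apply_two]; ring

theorem cross_smul_right (c : ℝ) (u w : E3) : cross u (c • w) = c • cross u w := by
  apply E3.ext_coord <;>
  simp only [PiLp.smul_apply, smul_eq_mul, cross_apply_zero, cross_apply_one, cross_apply_two] <;>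
  ring

theorem cross_sub_left (u v w : E3) : cross (u - v) w = cross u w - cross v w := by
  apply E3.ext_coord <;>
  simp only [PiLp.sub_apply, cross_apply_zero, cross_apply_one, cross_apply_two] <;>
  ring

theorem cross_smul_self (c : ℝ) (w : E3) : cross (c • w) w = 0 := by
  apply E3.ext_coord <;>
  simp only [PiLp.smul_apply, PiLp.zero_apply, smul_eq_mul, cross_apply_zero, cross_apply_one,
    cross_apply_two] <;>
  ring

theorem inner_cross_cross (a b c d : E3) :
    inner ℝ (cross a b) (cross c d) = inner ℝ a c * inner ℝ b d - inner ℝ a d * inner ℝ b c := by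
  simp only [inner_eq_sum, cross_apply_zero, cross_apply_one, cross_apply_two]; ring

theorem continuous_cross : Continuous fun p : E3 × E3 => cross p.1 p.2 := by
  unfold cross
  refine (PiLp.continuous_toLp 2 _).comp (continuous_pi fun i => ?_)
  fin_cases i <;> simp [crossProduct] <;> fun_prop

theorem continuous_app : Continuous fun p : Matrix (Fin 3) (Fin 3) ℝ × E3 => app p.1 p.2 := by
  unfold app
  refine (PiLp.continuous_toLp 2 _).comp ?_
  exact Continuous.matrix_mulVec continuous_fst (by fun_prop)

theorem app_smul (A : Matrix (Fin 3) (Fin 3) ℝ) (c : ℝ) (u : E3) : app A (c • u) = c • app A u := by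
  ext i; simp [app, Matrix.mulVec_smul]

theorem cross_eq_zero_iff {u w : E3} (hw : w ≠ 0) : cross u w = 0 ↔ u ∈ Submodule.span ℝ {w} := by
  rw [Submodule.mem_span_singleton]
  constructor
  · intro h
    refine ⟨inner ℝ u w / ‖w‖ ^ 2, ?_⟩
    have hn : ‖w‖ ^ 2 ≠ 0 := by positivity
    have h0 := congrArg (fun x : E3 => x 0) h
    have h1 := congrArg (fun x : E3 => x 1) h
    have h2 := congrArg (fun x : E3 => x 2) h
    simp only [cross_apply_zero, cross_apply_one, cross_apply_two, PiLp.zero_apply] at h0 h1 h2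
    -- This is w × (u × w) = |w|² u - (u · w) w with vanishing left side.
    have key : ‖w‖ ^ 2 • u = inner ℝ u w • w := by
      rw [← real_inner_self_eq_norm_sq]
      apply E3.ext_coord <;> simp only [inner_eq_sum, PiLp.smul_apply, smul_eq_mul]
      · linear_combination w 2 * -h1 + w 1 * h2
      · linear_combination w 2 * h0 - w 0 * h2
      · linear_combination w 0 * h1 - w 1 * h0
    rw [div_eq_inv_mul, mul_smul, ← key, smul_smul, inv_mul_cancel₀ hn, one_smul]
  · rintro ⟨c, rfl⟩
    exact cross_smul_self c w

/-- The kernel of the projection onto the complement of the line through τ is that line, and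
parallelism to τ is the vanishing of the cross product. This turns statements on normal velocities
into the form in which the defect appears. -/
theorem projPerp_eq_iff {τ u v : E3} (hτ : τ ≠ 0) :
    projPerp τ u = projPerp τ v ↔ cross (u - v) τ = 0 := by
  rw [cross_eq_zero_iff hτ, projPerp, projPerp, ← sub_eq_zero, ← map_sub,
    Submodule.starProjection_apply_eq_zero_iff, Submodule.orthogonal_orthogonal]

theorem fderiv_eq_sum (φ : E3 → E3) (x a : E3) (j : Fin 3) :
    fderiv ℝ φ x a j =
      a 0 * partialDeriv φ 0 j x + a 1 * partialDeriv φ 1 j x + a 2 * partialDeriv φ 2 j x := by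
  have ha : a = a 0 • EuclideanSpace.single 0 1 + a 1 • EuclideanSpace.single 1 1 +
      a 2 • EuclideanSpace.single 2 (1 : ℝ) := by
    apply E3.ext_coord <;> simp
  conv_lhs => rw [ha]
  simp [partialDeriv]

/-- The rotation is the axial vector of the antisymmetric part of the derivative. -/
theorem inner_rot_cross (φ : E3 → E3) (x a w : E3) :
    inner ℝ (rot φ x) (cross a w) =
      inner ℝ w (fderiv ℝ φ x a) - inner ℝ a (fderiv ℝ φ x w) := by
  simp only [inner_eq_sum, fderiv_eq_sum, cross_apply_zero, cross_apply_one, cross_apply_two]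
  simp [rot]
  ring

/-! ### The dissipation inequality -/

/-- The cyclic identity for the triple product moves τ onto Tb, which produces the Peach–Koehler
force τ × Tb paired with α̃. -/
theorem inner_app_cross_nonneg {αt : E3 → E3 → E3}
    (h : ∀ τ ∈ Metric.sphere (0 : E3) 1, ∀ ξ : E3, 0 ≤ inner ℝ ξ (αt τ ξ))
    (A : Matrix (Fin 3) (Fin 3) ℝ) (b : E3) {τ : E3} (hτ : ‖τ‖ = 1) :
    0 ≤ inner ℝ (app A (‖b‖⁻¹ • b)) (cross (αt τ (cross τ (app A b))) τ) := by
  rw [app_smul, inner_smul_left, inner_cross_rotate]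
  exact mul_nonneg (by simp) (h τ (by simpa using hτ) _)

theorem inner_app_alphaPoint_nonneg {αt : E3 → E3 → E3}
    (h : ∀ τ ∈ Metric.sphere (0 : E3) 1, ∀ ξ : E3, 0 ≤ inner ℝ ξ (αt τ ξ))
    (A : Matrix (Fin 3) (Fin 3) ℝ) (b ρ : E3) :
    0 ≤ inner ℝ (app A (‖b‖⁻¹ • b)) (alphaPoint αt A ρ b) := by
  rw [alphaPoint, inner_smul_right]
  rcases eq_or_ne ρ 0 with rfl | hρ
  · simp
  · refine mul_nonneg (norm_nonneg _) (inner_app_cross_nonneg h A b ?_)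
    rw [norm_smul, norm_inv, norm_norm, inv_mul_cancel₀ (norm_ne_zero_iff.2 hρ)]

/-- Almost every point lies in Ω and in the support of μ, and there τ is a unit vector, so the
pointwise inequality applies to the integrand. -/
theorem pairing_alphaDensity_nonneg {αt : E3 → E3 → E3}
    (h : ∀ τ ∈ Metric.sphere (0 : E3) 1, ∀ ξ : E3, 0 ≤ inner ℝ ξ (αt τ ξ))
    {Ω : Set E3} (T : E3 → Matrix (Fin 3) (Fin 3) ℝ) (b : E3) {μ : Measure E3} {τ : E3 → E3}
    (hμ : IsDislocationMeasure Ω μ τ) {ψ : E3 → ℝ} (hψ : ∀ x, 0 ≤ ψ x) :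
    0 ≤ pairing μ (alphaDensity αt T τ b) (fun x => ψ x • app (T x) (‖b‖⁻¹ • b)) := by
  refine integral_nonneg_of_ae ?_
  have h1 : ∀ᵐ x ∂μ, x ∈ μ.support := Measure.support_mem_ae
  have h2 : ∀ᵐ x ∂μ, x ∈ Ω := by
    rw [ae_iff]; exact hμ.compl_null
  filter_upwards [h1, h2] with x hx1 hx2
  rw [inner_smul_right, real_inner_comm]
  exact mul_nonneg (hψ x) (inner_app_cross_nonneg h (T x) b (hμ.norm_tangent x ⟨hx1, hx2⟩))

/-! ### The length of a regular curve and its Hausdorff measure -/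

section ArcLength

open scoped ENNReal NNReal

variable {E : Type*} [NormedAddCommGroup E] [NormedSpace ℝ E] {γ : ℝ → E}

/-- Mean value inequality for γ(s) - s v. It makes γ bi-Lipschitz, with constants |v| ± ε when |v| >
ε, where its derivative is ε-close to v. -/
theorem norm_image_sub_sub_smul_le {J : Set ℝ} (hJ : Convex ℝ J) (hγ : Differentiable ℝ γ) {v : E}
    {ε : ℝ} (h : ∀ s ∈ J, ‖deriv γ s - v‖ ≤ ε) {s s' : ℝ} (hs : s ∈ J) (hs' : s' ∈ J) :
    ‖γ s' - γ s - (s' - s) • v‖ ≤ ε * |s' - s| := by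
  have hd : ∀ x ∈ J, HasDerivWithinAt (fun σ => γ σ - σ • v) (deriv γ x - v) J x := by
    intro x _
    have h1 := ((hγ x).hasDerivAt.sub ((hasDerivAt_id x).smul_const v)).hasDerivWithinAt (s := J)
    rw [one_smul] at h1
    exact h1
  have := hJ.norm_image_sub_le_of_norm_hasDerivWithin_le hd h hs hs'
  rw [Real.norm_eq_abs] at this
  convert this using 2
  rw [sub_smul]; abel

variable [MeasurableSpace E] [BorelSpace E]

theorem hausdorffMeasure_image_le_of_norm_deriv_sub_le {J A : Set ℝ} (hJ : Convex ℝ J) (hA : A ⊆ J)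
    (hγ : Differentiable ℝ γ) {v : E} {ε : ℝ} (hε : 0 ≤ ε) (h : ∀ s ∈ J, ‖deriv γ s - v‖ ≤ ε) :
    (Measure.hausdorffMeasure 1 : Measure E) (γ '' A) ≤
      ENNReal.ofReal (‖v‖ + ε) * volume A := by
  have hL : LipschitzOnWith (Real.toNNReal (‖v‖ + ε)) γ A := by
    refine LipschitzOnWith.of_dist_le_mul fun s hs s' hs' => ?_
    rw [dist_eq_norm, Real.dist_eq, Real.coe_toNNReal _ (by positivity)]
    have h1 := norm_image_sub_sub_smul_le hJ hγ h (hA hs') (hA hs)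
    have h2 := norm_sub_norm_le (γ s - γ s') ((s - s') • v)
    rw [norm_smul, Real.norm_eq_abs] at h2
    linarith
  have := hL.hausdorffMeasure_image_le zero_le_one
  simpa [hausdorffMeasure_real, ENNReal.ofReal] using this

theorem le_hausdorffMeasure_image_of_norm_deriv_sub_le {J A : Set ℝ} (hJ : Convex ℝ J) (hA : A ⊆ J)
    (hγ : Differentiable ℝ γ) {v : E} {ε : ℝ} (h : ∀ s ∈ J, ‖deriv γ s - v‖ ≤ ε) :
    ENNReal.ofReal (‖v‖ - ε) * volume A ≤
      (Measure.hausdorffMeasure 1 : Measure E) (γ '' A) := by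
  rcases le_or_gt (‖v‖ - ε) 0 with hc | hc
  · simp [ENNReal.ofReal_of_nonpos hc]
  set K : ℝ≥0 := Real.toNNReal (‖v‖ - ε) with hK
  have hK0 : K ≠ 0 := by simpa [hK] using hc
  have hL : AntilipschitzWith K⁻¹ (A.domRestrict γ) := by
    refine AntilipschitzWith.of_le_mul_dist fun s s' => ?_
    rw [Subtype.dist_eq, Real.dist_eq, dist_eq_norm (A.domRestrict γ s), NNReal.coe_inv,
      Real.coe_toNNReal _ hc.le, inv_mul_eq_div, le_div_iff₀ hc]
    have h1 := norm_image_sub_sub_smul_le hJ hγ h (hA s'.2) (hA s.2)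
    have h2 := norm_sub_norm_le ((s.1 - s'.1) • v) (γ s - γ s')
    rw [norm_smul, Real.norm_eq_abs, norm_sub_rev ((s.1 - s'.1) • v)] at h2
    simp only [Set.domRestrict_apply]
    linarith
  have h1 := hL.le_hausdorffMeasure_image zero_le_one univ
  rw [image_univ, Set.range_domRestrict, ← isometry_subtype_coe.hausdorffMeasure_image
    (Or.inl zero_le_one), image_univ, Subtype.range_coe, hausdorffMeasure_real,
    ENNReal.rpow_one, ENNReal.coe_inv hK0] at h1
  have h2 := mul_le_mul_right h1 (K : ℝ≥0∞)
  rwa [← mul_assoc, ENNReal.mul_inv_cancel (by simpa using hK0) (by simp), one_mul] at h2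

/-- The length formula for subsets of an injective `C¹` arc. -/
theorem lintegral_norm_deriv_eq_hausdorffMeasure_image (hγ : ContDiff ℝ 1 γ) {a b : ℝ}
    (hinj : InjOn γ (Icc a b)) {A : Set ℝ} (hA : MeasurableSet A) (hAS : A ⊆ Icc a b) :
    ∫⁻ s in A, ENNReal.ofReal ‖deriv γ s‖ =
      (Measure.hausdorffMeasure 1 : Measure E) (γ '' A) := by
  have hγd : Differentiable ℝ γ := hγ.differentiable one_ne_zero
  have hγ' : Continuous (deriv γ) := hγ.continuous_deriv le_rfl
  have hAfin : volume A ≠ ⊤ := ((measure_mono hAS).trans_lt measure_Icc_lt_top).ne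
  -- Two-sided comparison with an error proportional to the length of A, which is finite, so the
  -- error disappears as ε → 0.
  suffices H : ∀ ε : ℝ, 0 < ε →
      ∫⁻ s in A, ENNReal.ofReal ‖deriv γ s‖ ≤
        (Measure.hausdorffMeasure 1 : Measure E) (γ '' A) + ENNReal.ofReal (2 * ε) * volume A ∧
      (Measure.hausdorffMeasure 1 : Measure E) (γ '' A) ≤
        (∫⁻ s in A, ENNReal.ofReal ‖deriv γ s‖) + ENNReal.ofReal (2 * ε) * volume A by
    have hlim : ∀ x : ℝ≥0∞, Tendsto (fun ε : ℝ => x + ENNReal.ofReal (2 * ε) * volume A) (𝓝[>] 0)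
        (𝓝 x) := by
      intro x
      have h1 : Tendsto (fun ε : ℝ => ENNReal.ofReal (2 * ε)) (𝓝[>] 0) (𝓝 0) := by
        have : Continuous fun ε : ℝ => ENNReal.ofReal (2 * ε) :=
          ENNReal.continuous_ofReal.comp (by fun_prop)
        simpa using (this.tendsto 0).mono_left nhdsWithin_le_nhds
      have h2 := ENNReal.Tendsto.mul_const (b := volume A) h1 (Or.inr hAfin)
      simpa using h2.const_add x
    exact le_antisymm
      (ge_of_tendsto (hlim _) (eventually_mem_nhdsWithin.mono fun ε hε => (H ε hε).1))
      (ge_of_tendsto (hlim _) (eventually_mem_nhdsWithin.mono fun ε hε => (H ε hε).2))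
  intro ε hε
  obtain ⟨δ, hδ, hδε⟩ := Metric.uniformContinuousOn_iff_le.1
    (isCompact_Icc.uniformContinuousOn_of_continuous (hγ'.continuousOn (s := Icc a b))) ε hε
  -- Cells as long as the modulus of continuity δ of γ': on each one γ' stays within ε of a fixed
  -- vector. Half-open cells are disjoint, and by injectivity so are the images of their parts in A.
  set I : ℤ → Set ℝ := fun k => Ico (k • δ) ((k + 1) • δ) with hI
  have hIdisj : Pairwise (Function.onFun Disjoint I) := pairwise_disjoint_Ico_zsmul δ
  have hAeq : A = ⋃ k, A ∩ I k := by
    rw [← inter_iUnion, hI, iUnion_Ico_zsmul hδ, inter_univ]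
  have hm : ∀ k, MeasurableSet (A ∩ I k) := fun k => hA.inter measurableSet_Ico
  have hd : Pairwise (Function.onFun Disjoint fun k => A ∩ I k) := fun i j hij =>
    (hIdisj hij).mono inter_subset_right inter_subset_right
  have e1 : ∫⁻ s in A, ENNReal.ofReal ‖deriv γ s‖ =
      ∑' k, ∫⁻ s in A ∩ I k, ENNReal.ofReal ‖deriv γ s‖ := by
    conv_lhs => rw [hAeq]
    exact lintegral_iUnion hm hd _
  have e2 : (Measure.hausdorffMeasure 1 : Measure E) (γ '' A) =
      ∑' k, (Measure.hausdorffMeasure 1 : Measure E) (γ '' (A ∩ I k)) := by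
    conv_lhs => rw [hAeq, image_iUnion]
    refine measure_iUnion (fun i j hij => ?_) fun k => ?_
    · refine Set.disjoint_left.2 ?_
      rintro _ ⟨x, hx, rfl⟩ ⟨y, hy, hxy⟩
      obtain rfl := hinj (hAS hy.1) (hAS hx.1) hxy
      exact Set.disjoint_left.1 (hd hij) hx hy
    · exact (hm k).image_of_continuousOn_injOn hγd.continuous.continuousOn
        (hinj.mono (inter_subset_left.trans hAS))
  have e3 : volume A = ∑' k, volume (A ∩ I k) := by
    conv_lhs => rw [hAeq]
    exact measure_iUnion hd hm
  have key : ∀ k, ∃ v : E, ∀ s ∈ I k ∩ Icc a b, ‖deriv γ s - v‖ ≤ ε := by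
    intro k
    rcases (I k ∩ Icc a b).eq_empty_or_nonempty with h | ⟨s₀, hs₀⟩
    · exact ⟨0, by simp [h]⟩
    · refine ⟨deriv γ s₀, fun s hs => ?_⟩
      rw [← dist_eq_norm]
      refine hδε s hs.2 s₀ hs₀.2 ?_
      have h1 := hs.1
      have h2 := hs₀.1
      simp only [hI, mem_Ico, add_smul, one_smul] at h1 h2
      rw [Real.dist_eq, abs_le]
      constructor <;> linarith [h1.1, h1.2, h2.1, h2.2]
  choose v hv using key
  have hJ : ∀ k, Convex ℝ (I k ∩ Icc a b) := fun k => (convex_Ico _ _).inter (convex_Icc _ _)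
  have hsub : ∀ k, A ∩ I k ⊆ I k ∩ Icc a b := fun k s hs => ⟨hs.2, hAS hs.1⟩
  -- Valid also for x < ε, where the truncated difference is zero. It joins the Lipschitz and
  -- anti-Lipschitz bounds at the cost of 2ε.
  have split : ∀ x : ℝ, 0 ≤ x → ENNReal.ofReal (x + ε) ≤
      ENNReal.ofReal (x - ε) + ENNReal.ofReal (2 * ε) := by
    intro x hx
    refine (ENNReal.ofReal_le_ofReal ?_).trans ENNReal.ofReal_add_le
    linarith
  have up : ∀ k, ∫⁻ s in A ∩ I k, ENNReal.ofReal ‖deriv γ s‖ ≤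
      ENNReal.ofReal (‖v k‖ + ε) * volume (A ∩ I k) := by
    intro k
    rw [← setLIntegral_const]
    refine setLIntegral_mono' (hm k) fun s hs => ENNReal.ofReal_le_ofReal ?_
    have := norm_sub_norm_le (deriv γ s) (v k)
    linarith [hv k s (hsub k hs)]
  have low : ∀ k, ENNReal.ofReal (‖v k‖ - ε) * volume (A ∩ I k) ≤
      ∫⁻ s in A ∩ I k, ENNReal.ofReal ‖deriv γ s‖ := by
    intro k
    rw [← setLIntegral_const]
    refine setLIntegral_mono' (hm k) fun s hs => ENNReal.ofReal_le_ofReal ?_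
    have := norm_sub_norm_le (v k) (deriv γ s)
    rw [norm_sub_rev] at this
    linarith [hv k s (hsub k hs)]
  rw [e1, e2, e3, ← ENNReal.tsum_mul_left, ← ENNReal.tsum_add, ← ENNReal.tsum_add]
  constructor <;> refine ENNReal.tsum_le_tsum fun k => ?_
  · refine (up k).trans ((mul_le_mul_left (split _ (norm_nonneg _)) _).trans ?_)
    rw [add_mul]
    gcongr
    exact le_hausdorffMeasure_image_of_norm_deriv_sub_le (hJ k) (hsub k) hγd (hv k)
  · refine (hausdorffMeasure_image_le_of_norm_deriv_sub_le (hJ k) (hsub k) hγd hε.le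
      (hv k)).trans ((mul_le_mul_left (split _ (norm_nonneg _)) _).trans ?_)
    rw [add_mul]
    gcongr
    exact low k

/-- The length formula as an equality of measures. As γ restricted to the interval is a measurable
embedding, it transfers integrals and integrability of arbitrary functions, with no measurability
assumption. -/
theorem restrict_map_withDensity_norm_deriv (hγ : ContDiff ℝ 1 γ) {a b : ℝ}
    (hinj : InjOn γ (Icc a b)) :
    Measure.map ((Icc a b).domRestrict γ)
      (Measure.comap (↑) (volume.withDensity fun s => ENNReal.ofReal ‖deriv γ s‖)) =
      (Measure.hausdorffMeasure 1 : Measure E).restrict (γ '' Icc a b) := by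
  have hγc : Continuous γ := hγ.continuous
  have e : (Icc a b).domRestrict γ = γ ∘ Subtype.val := rfl
  rw [e, ← Measure.map_map hγc.measurable measurable_subtype_coe,
    map_comap_subtype_coe measurableSet_Icc]
  refine Measure.ext fun t ht => ?_
  have hpre := hγc.measurable ht
  rw [Measure.map_apply hγc.measurable ht, Measure.restrict_apply hpre,
    withDensity_apply _ (hpre.inter measurableSet_Icc), Measure.restrict_apply ht,
    lintegral_norm_deriv_eq_hausdorffMeasure_image hγ hinj (hpre.inter measurableSet_Icc)
      inter_subset_right, image_preimage_inter]

theorem integrableOn_image_iff_norm_deriv_smul (hγ : ContDiff ℝ 1 γ) {a b : ℝ}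
    (hinj : InjOn γ (Icc a b)) (f : E → ℝ) :
    IntegrableOn f (γ '' Icc a b) (Measure.hausdorffMeasure 1) ↔
      IntegrableOn (fun s => ‖deriv γ s‖ * f (γ s)) (Icc a b) := by
  have hemb := hγ.continuous.continuousOn.measurableEmbedding measurableSet_Icc hinj
  rw [IntegrableOn, ← restrict_map_withDensity_norm_deriv hγ hinj, hemb.integrable_map_iff]
  have e : f ∘ (Icc a b).domRestrict γ = (f ∘ γ) ∘ Subtype.val := rfl
  simp only [ENNReal.ofReal]
  rw [e, ← (MeasurableEmbedding.subtype_coe measurableSet_Icc).integrable_map_iff,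
    map_comap_subtype_coe measurableSet_Icc,
    restrict_withDensity measurableSet_Icc, integrable_withDensity_iff_integrable_coe_smul₀]
  · simp_rw [IntegrableOn, Real.coe_toNNReal _ (norm_nonneg _), Function.comp_apply, smul_eq_mul]
  · exact (hγ.continuous_deriv le_rfl).norm.measurable.real_toNNReal.aemeasurable

theorem integral_image_eq_integral_norm_deriv_smul (hγ : ContDiff ℝ 1 γ) {a b : ℝ}
    (hinj : InjOn γ (Icc a b)) (f : E → ℝ) :
    ∫ x in γ '' Icc a b, f x ∂(Measure.hausdorffMeasure 1) =
      ∫ s in Icc a b, ‖deriv γ s‖ * f (γ s) := by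
  have hemb := hγ.continuous.continuousOn.measurableEmbedding measurableSet_Icc hinj
  rw [← restrict_map_withDensity_norm_deriv hγ hinj, hemb.integral_map]
  simp only [Set.domRestrict_apply, ← Function.comp_apply (f := f), ENNReal.ofReal]
  rw [← (MeasurableEmbedding.subtype_coe measurableSet_Icc).integral_map
    (g := fun s => (f ∘ γ) s),
    map_comap_subtype_coe measurableSet_Icc,
    setIntegral_withDensity_eq_setIntegral_smul₀
      (hγ.continuous_deriv le_rfl).norm.measurable.real_toNNReal.aemeasurable _ measurableSet_Icc]
  congr with x
  rw [NNReal.smul_def, Real.coe_toNNReal _ (norm_nonneg _)]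
  rfl

end ArcLength

/-! ### Interchanging two directional derivatives under the integral sign -/

section Interchange

open scoped Convolution

theorem fderiv_convolution_right_apply {f g : ℝ × ℝ → ℝ} (hf : LocallyIntegrable f volume)
    (hg : ContDiff ℝ 1 g) (hgc : HasCompactSupport g) (x v : ℝ × ℝ) :
    fderiv ℝ (f ⋆[ContinuousLinearMap.mul ℝ ℝ, volume] g) x v =
      (f ⋆[ContinuousLinearMap.mul ℝ ℝ, volume] fun z => fderiv ℝ g z v) x := by
  rw [(hgc.hasFDerivAt_convolution_right (ContinuousLinearMap.mul ℝ ℝ) hf hg x).fderiv]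
  exact convolution_precompR_apply _ hf (hgc.fderiv ℝ) (hg.continuous_fderiv one_ne_zero) x v

theorem mul_convolution_comm (f g : ℝ × ℝ → ℝ) :
    (f ⋆[ContinuousLinearMap.mul ℝ ℝ, volume] g) = g ⋆[ContinuousLinearMap.mul ℝ ℝ, volume] f := by
  rw [← convolution_flip]
  congr 1
  ext; simp

/-- Two integrations by parts would need second derivatives. Instead, with G(z) = g(-z), the
integral is minus the value at 0 of ∂ᵤf ⋆ ∂ᵥG. A derivative of a convolution may fall on either
factor, so ∂ᵤf ⋆ ∂ᵥG = ∂ᵥ(∂ᵤf ⋆ G) = ∂ᵥ(f ⋆ ∂ᵤG) = ∂ᵥf ⋆ ∂ᵤG. -/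
theorem integral_fderiv_mul_fderiv_comm_of_hasCompactSupport {f g : ℝ × ℝ → ℝ}
    (hf : ContDiff ℝ 1 f) (hfc : HasCompactSupport f) (hg : ContDiff ℝ 1 g)
    (hgc : HasCompactSupport g) (u v : ℝ × ℝ) :
    ∫ z, fderiv ℝ f z u * fderiv ℝ g z v = ∫ z, fderiv ℝ f z v * fderiv ℝ g z u := by
  have hl : ∀ {h : ℝ × ℝ → ℝ}, ContDiff ℝ 1 h → ∀ w, LocallyIntegrable (fun z => fderiv ℝ h z w)
      volume := fun hh w =>
    ((hh.continuous_fderiv one_ne_zero).clm_apply continuous_const).locallyIntegrable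
  set G : ℝ × ℝ → ℝ := fun z => g (-z) with hG
  have hGd : ContDiff ℝ 1 G := hg.comp contDiff_neg
  have hGc : HasCompactSupport G := hgc.comp_homeomorph (Homeomorph.neg _)
  have hGf : ∀ z w, fderiv ℝ G z w = - fderiv ℝ g (-z) w := by
    intro z w
    have : fderiv ℝ G z = (fderiv ℝ g (-z)).comp (-ContinuousLinearMap.id ℝ (ℝ × ℝ)) :=
      ((hg.differentiable one_ne_zero (-z)).hasFDerivAt.comp z (hasFDerivAt_id z).neg).fderiv
    rw [this]; simp
  have key : ∀ w w' : ℝ × ℝ,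
      ((fun z => fderiv ℝ f z w) ⋆[ContinuousLinearMap.mul ℝ ℝ, volume] fun z => fderiv ℝ G z w') 0 =
        - ∫ z, fderiv ℝ f z w * fderiv ℝ g z w' := by
    intro w w'
    rw [convolution_def, ← integral_neg]
    congr with z
    simp [hGf]
  have e : ((fun z => fderiv ℝ f z u) ⋆[ContinuousLinearMap.mul ℝ ℝ, volume] G) =
      f ⋆[ContinuousLinearMap.mul ℝ ℝ, volume] fun z => fderiv ℝ G z u := by
    funext x
    rw [← fderiv_convolution_right_apply hf.continuous.locallyIntegrable hGd hGc, mul_convolution_comm,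
      ← fderiv_convolution_right_apply hGd.continuous.locallyIntegrable hf hfc, mul_convolution_comm]
  have h1 := key u v
  rw [← fderiv_convolution_right_apply (hl hf u) hGd hGc, e, mul_convolution_comm,
    fderiv_convolution_right_apply (hl hGd u) hf hfc, mul_convolution_comm, key v u] at h1
  linarith

theorem integral_fderiv_mul_fderiv_comm {f g : ℝ × ℝ → ℝ} (hf : ContDiff ℝ 1 f)
    (hg : ContDiff ℝ 1 g) (hgc : HasCompactSupport g) (u v : ℝ × ℝ) :
    ∫ z, fderiv ℝ f z u * fderiv ℝ g z v = ∫ z, fderiv ℝ f z v * fderiv ℝ g z u := by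
  obtain ⟨R, hR, hgR⟩ := hgc.isBounded.subset_ball_lt 0 (0 : ℝ × ℝ)
  -- Equal to 1 on a ball containing the support of g, so cutting off f changes neither integrand.
  let χ : ContDiffBump (0 : ℝ × ℝ) := ⟨R, R + 1, hR, by linarith⟩
  have h := integral_fderiv_mul_fderiv_comm_of_hasCompactSupport (f := fun z => χ z * f z)
    (χ.contDiff.mul hf) χ.hasCompactSupport.mul_right hg hgc u v
  have e : ∀ w w' : ℝ × ℝ, (fun z => fderiv ℝ (fun z => χ z * f z) z w * fderiv ℝ g z w') =
      fun z => fderiv ℝ f z w * fderiv ℝ g z w' := by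
    intro w w'
    funext z
    by_cases hz : z ∈ tsupport g
    · have : (fun z => χ z * f z) =ᶠ[𝓝 z] f := by
        filter_upwards [χ.eventuallyEq_one_of_mem_ball (hgR hz)] with y hy
        rw [hy]; simp
      rw [this.fderiv_eq]
    · have : fderiv ℝ g z = 0 := by
        rw [(notMem_tsupport_iff_eventuallyEq.1 hz).fderiv_eq]; simp
      simp [this]
  rwa [e, e] at h

/-- For `C¹` maps `Y`, `ψ` with `ψ` compactly supported, the integral of the Jacobian type
expression `∂ₛY · ∂ₜψ - ∂ₜY · ∂ₛψ` vanishes. -/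
theorem integral_inner_fderiv_sub_eq_zero {Y ψ : ℝ × ℝ → E3} (hY : ContDiff ℝ 1 Y)
    (hψ : ContDiff ℝ 1 ψ) (hψc : HasCompactSupport ψ) (u v : ℝ × ℝ) :
    ∫ z, (inner ℝ (fderiv ℝ Y z u) (fderiv ℝ ψ z v) - inner ℝ (fderiv ℝ Y z v) (fderiv ℝ ψ z u)) =
      0 := by
  have hcomp : ∀ i, ContDiff ℝ 1 (fun z => Y z i) ∧ ContDiff ℝ 1 (fun z => ψ z i) := fun i =>
    ⟨contDiff_euclidean.1 hY i, contDiff_euclidean.1 hψ i⟩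
  have hcs : ∀ i, HasCompactSupport fun z => ψ z i := fun i =>
    hψc.comp_left (g := fun x : E3 => x i) (by simp)
  have hfd : ∀ {Z : ℝ × ℝ → E3}, ContDiff ℝ 1 Z → ∀ z w i,
      (fderiv ℝ Z z w) i = fderiv ℝ (fun z => Z z i) z w := by
    intro Z hZ z w i
    have h1 := (hZ.differentiable one_ne_zero z).hasFDerivAt
    have h2 := ((EuclideanSpace.proj i : E3 →L[ℝ] ℝ).hasFDerivAt.comp z h1).fderiv
    exact (congrArg (fun A => A w) h2).symm
  have hint : ∀ (w w' : ℝ × ℝ) i, Integrable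
      (fun z => fderiv ℝ (fun z => Y z i) z w * fderiv ℝ (fun z => ψ z i) z w') volume := by
    intro w w' i
    refine Continuous.integrable_of_hasCompactSupport
      ((((hcomp i).1.continuous_fderiv one_ne_zero).clm_apply continuous_const).mul
      (((hcomp i).2.continuous_fderiv one_ne_zero).clm_apply continuous_const)) ?_
    exact ((hcs i).fderiv_apply ℝ w').mul_left
  have e : ∀ z, inner ℝ (fderiv ℝ Y z u) (fderiv ℝ ψ z v) -
      inner ℝ (fderiv ℝ Y z v) (fderiv ℝ ψ z u) =
      ∑ i, (fderiv ℝ (fun z => Y z i) z u * fderiv ℝ (fun z => ψ z i) z v -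
        fderiv ℝ (fun z => Y z i) z v * fderiv ℝ (fun z => ψ z i) z u) := by
    intro z
    simp only [inner_eq_sum, hfd hY, hfd hψ, Fin.sum_univ_three]; ring
  simp_rw [e]
  refine (integral_finsetSum _ fun i _ => (hint u v i).sub (hint v u i)).trans ?_
  refine Finset.sum_eq_zero fun i _ => ?_
  rw [Pi.sub_def, integral_sub (hint u v i) (hint v u i),
    integral_fderiv_mul_fderiv_comm (hcomp i).1 (hcomp i).2 (hcs i), sub_self]

end Interchange

/-! ### Charts of a moving curve -/

section Chart

/-- The derivative in time of a parametrization `(t, s) ↦ Y (t, s)`. -/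
noncomputable def velocity (Y : ℝ × ℝ → E3) (z : ℝ × ℝ) : E3 := fderiv ℝ Y z (1, 0)

/-- The derivative in `s` of a parametrization `(t, s) ↦ Y (t, s)`. -/
noncomputable def tangent (Y : ℝ × ℝ → E3) (z : ℝ × ℝ) : E3 := fderiv ℝ Y z (0, 1)

variable {Y : ℝ × ℝ → E3}

theorem continuous_velocity (hY : ContDiff ℝ 1 Y) : Continuous (velocity Y) :=
  (hY.continuous_fderiv one_ne_zero).clm_apply continuous_const

theorem continuous_tangent (hY : ContDiff ℝ 1 Y) : Continuous (tangent Y) :=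
  (hY.continuous_fderiv one_ne_zero).clm_apply continuous_const

theorem hasDerivAt_tangent (hY : ContDiff ℝ 1 Y) (t s : ℝ) :
    HasDerivAt (fun σ => Y (t, σ)) (tangent Y (t, s)) s :=
  (hY.differentiable one_ne_zero (t, s)).hasFDerivAt.comp_hasDerivAt s
    ((hasDerivAt_const s t).prodMk (hasDerivAt_id s))

theorem deriv_eq_tangent (hY : ContDiff ℝ 1 Y) (t s : ℝ) :
    deriv (fun σ => Y (t, σ)) s = tangent Y (t, s) :=
  (hasDerivAt_tangent hY t s).deriv

theorem contDiff_slice (hY : ContDiff ℝ 1 Y) (t : ℝ) : ContDiff ℝ 1 fun σ => Y (t, σ) :=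
  hY.comp (contDiff_const.prodMk contDiff_id)

/-- A regular parametrization `Y` of a moving curve in the open set `U`, for times in the open
set `J` and parameters in `[-r, r]`, the directions of which stay within acute angles. -/
structure IsChart (Ω : Set E3) (Te : ℝ) (ℓ : ℝ → Set E3) (τ : ℝ → E3 → E3)
    (Y : ℝ × ℝ → E3) (J : Set ℝ) (r : ℝ) (U : Set E3) : Prop where
  contDiff : ContDiff ℝ 1 Y
  isOpen_time : IsOpen J
  isOpen_space : IsOpen U
  subset : U ⊆ Ω
  image_eq : ∀ t ∈ J ∩ Ico 0 Te, ℓ t ∩ U = (fun s => Y (t, s)) '' Icc (-r) r ∩ U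
  tangent_eq : ∀ t ∈ J ∩ Ico 0 Te, ∀ s ∈ Icc (-r) r, Y (t, s) ∈ U →
    τ t (Y (t, s)) = ‖tangent Y (t, s)‖⁻¹ • tangent Y (t, s)
  inner_pos : ∀ z ∈ J ×ˢ Icc (-r) r, ∀ z' ∈ J ×ˢ Icc (-r) r,
    0 < inner ℝ (tangent Y z) (tangent Y z')
  mem_Ioo : ∀ t ∈ J, ∀ s ∈ Icc (-r) r, Y (t, s) ∈ U → s ∈ Ioo (-r) r

variable {Ω : Set E3} {Te : ℝ} {ℓ : ℝ → Set E3} {τ : ℝ → E3 → E3} {J : Set ℝ} {r : ℝ} {U : Set E3}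

/-- Continuity of the nonzero tangent gives the positive inner products after shrinking. The space
neighbourhood must shrink along with the parameter interval, so that no point of the curve is lost
and no endpoint is seen. -/
theorem IsMovingCurve.exists_isChart (h : IsMovingCurve Ω Te ℓ τ) (hΩ : IsOpen Ω) {t₀ : ℝ}
    (ht₀ : t₀ ∈ Ico 0 Te) {x₀ : E3} (hx₀ : x₀ ∈ ℓ t₀) :
    ∃ Y J r U, IsChart Ω Te ℓ τ Y J r U ∧ 0 < r ∧ t₀ ∈ J ∧ x₀ ∈ U ∧ Y (t₀, 0) = x₀ := by
  obtain ⟨Y, δ, hδ, r, hr, U₀, hU₀, hY, hY₀, hch⟩ := h.exists_chart t₀ ht₀ x₀ hx₀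
  have h0 : (0 : ℝ) ∈ Icc (-r) r := ⟨by linarith, hr.le⟩
  have hw : tangent Y (t₀, 0) ≠ 0 := by
    rw [← deriv_eq_tangent hY]
    exact ((hch t₀ ht₀ (by simpa using hδ)).2.2 0 h0).1
  have hpos : ∀ᶠ p : (ℝ × ℝ) × (ℝ × ℝ) in 𝓝 ((t₀, 0), (t₀, 0)),
      0 < inner ℝ (tangent Y p.1) (tangent Y p.2) := by
    have hc : Continuous fun p : (ℝ × ℝ) × (ℝ × ℝ) => inner ℝ (tangent Y p.1) (tangent Y p.2) :=
      ((continuous_tangent hY).comp continuous_fst).inner ((continuous_tangent hY).comp continuous_snd)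
    exact hc.continuousAt.eventually_const_lt (real_inner_self_pos.2 hw)
  obtain ⟨ε, hε, hball⟩ := Metric.eventually_nhds_iff_ball.1 hpos
  set r' : ℝ := min r ε / 2 with hr'
  have hr'0 : 0 < r' := by positivity
  have hr'r : r' < r := by have := min_le_left r ε; rw [hr']; linarith
  have hr'ε : r' < ε := by have := min_le_right r ε; rw [hr']; linarith
  have hS : IsCompact (Icc (-r) r ∩ {s : ℝ | r' ≤ |s|}) :=
    isCompact_Icc.inter_right (isClosed_le continuous_const continuous_abs)
  -- At time t₀ parameters away from 0 do not hit x₀, by injectivity. Compactness makes this stable,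
  -- so curve points near x₀ have parameters strictly inside (-r', r').
  have hev : ∀ᶠ p : ℝ × E3 in 𝓝 (t₀, x₀), ∀ s ∈ Icc (-r) r ∩ {s : ℝ | r' ≤ |s|},
      Y (p.1, s) ≠ p.2 := by
    refine hS.eventually_forall_of_forall_eventually fun s hs => ?_
    have hc1 : ContinuousAt (fun q : (ℝ × E3) × ℝ => Y (q.1.1, q.2)) ((t₀, x₀), s) :=
      (hY.continuous.comp (by fun_prop)).continuousAt
    have hc2 : ContinuousAt (fun q : (ℝ × E3) × ℝ => q.1.2) ((t₀, x₀), s) :=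
      continuousAt_fst.snd
    refine (hc1.prodMk hc2).eventually (isOpen_ne_fun continuous_fst continuous_snd |>.mem_nhds ?_)
    intro he
    have hs0 : s = 0 := (hch t₀ ht₀ (by simpa using hδ)).1 hs.1 h0 (he.trans hY₀.symm)
    have := hs.2
    rw [hs0, mem_ofPred_eq, abs_zero] at this
    linarith
  obtain ⟨V, W, hV, htV, hW, hxW, hVW⟩ := mem_nhds_prod_iff'.1 hev
  have hxΩ : x₀ ∈ Ω := h.subset t₀ ht₀ hx₀
  have hxU₀ : x₀ ∈ interior U₀ := mem_interior_iff_mem_nhds.2 hU₀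
  have hmem : ∀ {t s : ℝ}, t ∈ V → s ∈ Icc (-r) r → Y (t, s) ∈ W → |s| < r' := by
    intro t s ht hs hy
    by_contra hlt
    exact hVW (show (t, Y (t, s)) ∈ V ×ˢ W from ⟨ht, hy⟩) s ⟨hs, not_lt.1 hlt⟩ rfl
  have hsubI : Icc (-r') r' ⊆ Icc (-r) r := Icc_subset_Icc (by linarith) hr'r.le
  refine ⟨Y, Metric.ball t₀ (min δ ε) ∩ V, r', interior U₀ ∩ Ω ∩ W,
    ⟨hY, Metric.isOpen_ball.inter hV, (isOpen_interior.inter hΩ).inter hW,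
      fun x hx => hx.1.2, ?_, ?_, ?_, ?_⟩, hr'0,
    ⟨Metric.mem_ball_self (lt_min hδ hε), htV⟩, ⟨⟨hxU₀, hxΩ⟩, hxW⟩, hY₀⟩
  · rintro t ⟨⟨ht, htV⟩, htI⟩
    have ht' : |t - t₀| < δ := by
      rw [← Real.dist_eq]; exact lt_of_lt_of_le ht (min_le_left _ _)
    have key := (hch t htI ht').2.1
    ext x
    constructor
    · rintro ⟨hxl, hxU⟩
      have : x ∈ ℓ t ∩ U₀ := ⟨hxl, interior_subset hxU.1.1⟩
      rw [key] at this
      obtain ⟨⟨s, hs, rfl⟩, -⟩ := this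
      exact ⟨⟨s, abs_le.1 (hmem htV hs hxU.2).le, rfl⟩, hxU⟩
    · rintro ⟨⟨s, hs, rfl⟩, hxU⟩
      have : Y (t, s) ∈ ℓ t ∩ U₀ := by
        rw [key]
        exact ⟨⟨s, hsubI hs, rfl⟩, interior_subset hxU.1.1⟩
      exact ⟨this.1, hxU⟩
  · rintro t ⟨⟨ht, htV⟩, htI⟩ s hs hyU
    have ht' : |t - t₀| < δ := by
      rw [← Real.dist_eq]; exact lt_of_lt_of_le ht (min_le_left _ _)
    rw [← deriv_eq_tangent hY]
    exact ((hch t htI ht').2.2 s (hsubI hs)).2 (interior_subset hyU.1.1)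
  · rintro ⟨t, s⟩ ⟨⟨ht, -⟩, hs⟩ ⟨t', s'⟩ ⟨⟨ht', -⟩, hs'⟩
    have hd : ∀ {σ : ℝ}, σ ∈ Icc (-r') r' → dist σ 0 < ε := fun hσ => by
      rw [Real.dist_eq, sub_zero]; exact (abs_le.2 hσ).trans_lt hr'ε
    refine hball ((t, s), (t', s')) ?_
    simp only [Metric.mem_ball, Prod.dist_eq, max_lt_iff]
    exact ⟨⟨lt_of_lt_of_le ht (min_le_right _ _), hd hs⟩,
      lt_of_lt_of_le ht' (min_le_right _ _), hd hs'⟩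
  · rintro t ⟨-, htV⟩ s hs hyU
    exact abs_lt.1 (hmem htV (hsubI hs) hyU.2)

namespace IsChart

theorem tangent_ne_zero (h : IsChart Ω Te ℓ τ Y J r U) {t s : ℝ} (ht : t ∈ J)
    (hs : s ∈ Icc (-r) r) : tangent Y (t, s) ≠ 0 := by
  rw [← real_inner_self_pos]
  exact h.inner_pos _ ⟨ht, hs⟩ _ ⟨ht, hs⟩

/-- The derivative in s is the inner product of two tangents of the chart, which is positive. This
gives injectivity, and uniqueness of the intersection with a normal plane. -/
theorem strictMonoOn_inner (h : IsChart Ω Te ℓ τ Y J r U) {t t₁ s₁ : ℝ} (ht : t ∈ J) (ht₁ : t₁ ∈ J)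
    (hs₁ : s₁ ∈ Icc (-r) r) (x : E3) :
    StrictMonoOn (fun s => inner ℝ (Y (t, s) - x) (tangent Y (t₁, s₁))) (Icc (-r) r) := by
  have hd : ∀ s, HasDerivAt (fun s => inner ℝ (Y (t, s) - x) (tangent Y (t₁, s₁)))
      (inner ℝ (tangent Y (t, s)) (tangent Y (t₁, s₁))) s := by
    intro s
    have := ((hasDerivAt_tangent h.contDiff t s).sub_const x).inner ℝ
      (hasDerivAt_const s (tangent Y (t₁, s₁)))
    simpa using this
  refine strictMonoOn_of_deriv_pos (convex_Icc _ _)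
    (fun s _ => (hd s).continuousAt.continuousWithinAt) fun s hs => ?_
  rw [(hd s).deriv]
  exact h.inner_pos _ ⟨ht, interior_subset hs⟩ _ ⟨ht₁, hs₁⟩

theorem injOn (h : IsChart Ω Te ℓ τ Y J r U) {t : ℝ} (ht : t ∈ J) :
    InjOn (fun s => Y (t, s)) (Icc (-r) r) := by
  intro s hs s' hs' he
  refine (h.strictMonoOn_inner ht ht hs 0).injOn hs hs' ?_
  simp only [he]

theorem mem_curve (h : IsChart Ω Te ℓ τ Y J r U) {t s : ℝ} (ht : t ∈ J) (htI : t ∈ Ico 0 Te)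
    (hs : s ∈ Icc (-r) r) (hU : Y (t, s) ∈ U) : Y (t, s) ∈ ℓ t := by
  have : Y (t, s) ∈ ℓ t ∩ U := by
    rw [h.image_eq t ⟨ht, htI⟩]
    exact ⟨⟨s, hs, rfl⟩, hU⟩
  exact this.1

/-- Solve w · (Y(t, s) - x₁) = 0 for s = σ(t), where w = ∂ₛY(t₁, s₁); the derivative in s is |w|² ≠
0. The point Y(t, σ(t)) moves with velocity ∂ₜY + σ' w, which differs from ∂ₜY by a tangential
vector. -/
theorem hasNormalVelocity (h : IsChart Ω Te ℓ τ Y J r U) {t₁ s₁ : ℝ} (ht₁ : t₁ ∈ J)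
    (htI : t₁ ∈ Ico 0 Te) (hs₁ : s₁ ∈ Icc (-r) r) (hU : Y (t₁, s₁) ∈ U) :
    HasNormalVelocity Te ℓ τ t₁ (Y (t₁, s₁))
      (projPerp (τ t₁ (Y (t₁, s₁))) (velocity Y (t₁, s₁))) := by
  set x₁ := Y (t₁, s₁) with hx₁
  set w := tangent Y (t₁, s₁) with hw
  have hw0 : w ≠ 0 := h.tangent_ne_zero ht₁ hs₁
  have hτ : τ t₁ x₁ = ‖w‖⁻¹ • w := h.tangent_eq t₁ ⟨ht₁, htI⟩ s₁ hs₁ hU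
  have hwn : ‖w‖ ≠ 0 := norm_ne_zero_iff.2 hw0
  have hww : inner ℝ w w ≠ 0 := (real_inner_self_pos.2 hw0).ne'
  have hplane : ∀ z : E3, inner ℝ (z - x₁) (τ t₁ x₁) = 0 ↔ inner ℝ (z - x₁) w = 0 := by
    intro z
    rw [hτ, inner_smul_right, mul_eq_zero, or_iff_right (inv_ne_zero hwn)]
  set f : ℝ × ℝ → ℝ := fun z => inner ℝ w (Y z - x₁) with hf
  have hY' := h.contDiff.hasStrictFDerivAt (x := (t₁, s₁)) one_ne_zero
  set f' : ℝ × ℝ →L[ℝ] ℝ := (innerSL ℝ w).comp (fderiv ℝ Y (t₁, s₁)) with hf'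
  have hfd : HasStrictFDerivAt f f' (t₁, s₁) :=
    (innerSL ℝ w).hasStrictFDerivAt.comp (t₁, s₁) (hY'.sub_const x₁)
  have hinr : f'.comp (ContinuousLinearMap.inr ℝ ℝ ℝ) =
      ((ContinuousLinearEquiv.unitsEquivAut ℝ (Units.mk0 _ hww) : ℝ ≃L[ℝ] ℝ) : ℝ →L[ℝ] ℝ) := by
    ext
    simp [hf', hw, tangent]
  have hinv : (f'.comp (ContinuousLinearMap.inr ℝ ℝ ℝ)).IsInvertible := ⟨_, hinr.symm⟩
  set σ : ℝ → ℝ := hfd.implicitFunctionOfProdDomain hinv with hσ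
  have hσd : DifferentiableAt ℝ σ t₁ :=
    (hfd.hasStrictFDerivAt_implicitFunctionOfProdDomain hinv).hasFDerivAt.differentiableAt
  have hσt : Tendsto σ (𝓝 t₁) (𝓝 s₁) := hfd.tendsto_implicitFunctionOfProdDomain hinv
  have hσ1 : σ t₁ = s₁ := tendsto_nhds_unique hσd.continuousAt.tendsto hσt
  have hσf : ∀ᶠ t in 𝓝 t₁, f (t, σ t) = 0 := by
    have := hfd.eventually_apply_implicitFunctionOfProdDomain hinv
    simpa [hf, hx₁] using this
  have hsIoo := h.mem_Ioo t₁ ht₁ s₁ hs₁ hU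
  have hYt : Tendsto (fun t => Y (t, σ t)) (𝓝 t₁) (𝓝 x₁) :=
    (h.contDiff.continuous.tendsto (t₁, s₁)).comp (tendsto_id.prodMk_nhds hσt)
  have hYd : HasDerivAt (fun t => Y (t, σ t)) (velocity Y (t₁, s₁) + deriv σ t₁ • w) t₁ := by
    have h1 : HasDerivAt (fun t => (t, σ t)) (1, deriv σ t₁) t₁ :=
      (hasDerivAt_id t₁).prodMk hσd.hasDerivAt
    have h2 : HasFDerivAt Y (fderiv ℝ Y (t₁, s₁)) (t₁, σ t₁) := by
      rw [hσ1]; exact hY'.hasFDerivAt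
    have h3 := h2.comp_hasDerivAt t₁ h1
    have e : fderiv ℝ Y (t₁, s₁) (1, deriv σ t₁) = velocity Y (t₁, s₁) + deriv σ t₁ • w := by
      have : ((1 : ℝ), deriv σ t₁) = (1, 0) + deriv σ t₁ • ((0 : ℝ), (1 : ℝ)) := by simp
      rw [this, map_add, map_smul]; rfl
    rwa [e] at h3
  refine ⟨fun t => Y (t, σ t), by simp only [hσ1, hx₁], ⟨U, h.isOpen_space.mem_nhds hU, ?_⟩, ?_⟩
  · have e1 : ∀ᶠ t in 𝓝 t₁, f (t, σ t) = 0 ∧ σ t ∈ Ioo (-r) r ∧ Y (t, σ t) ∈ U ∧ t ∈ J :=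
      hσf.and ((hσt.eventually (isOpen_Ioo.mem_nhds hsIoo)).and
        ((hYt.eventually (h.isOpen_space.mem_nhds hU)).and (h.isOpen_time.mem_nhds ht₁)))
    filter_upwards [nhdsWithin_le_nhds e1, self_mem_nhdsWithin] with t ht htI'
    obtain ⟨h1, h2, h3, h4⟩ := ht
    ext z
    simp only [mem_inter_iff, mem_ofPred_eq, mem_singleton_iff, hplane]
    constructor
    · rintro ⟨⟨hz, hz0⟩, hzU⟩
      have : z ∈ ℓ t ∩ U := ⟨hz, hzU⟩
      rw [h.image_eq t ⟨h4, htI'⟩] at this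
      obtain ⟨⟨s, hs, rfl⟩, -⟩ := this
      have : s = σ t := by
        refine (h.strictMonoOn_inner h4 ht₁ hs₁ x₁).injOn hs (Ioo_subset_Icc_self h2) ?_
        change inner ℝ (Y (t, s) - x₁) w = inner ℝ (Y (t, σ t) - x₁) w
        rw [hz0, real_inner_comm]
        exact h1.symm
      rw [this]
    · rintro rfl
      refine ⟨⟨h.mem_curve h4 htI' (Ioo_subset_Icc_self h2) h3, ?_⟩, h3⟩
      rw [real_inner_comm]; exact h1
  -- The moving point stays in the normal plane, so its velocity is orthogonal to w.
  · have horth : inner ℝ w (velocity Y (t₁, s₁) + deriv σ t₁ • w) = 0 := by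
      have h1 : HasDerivAt (fun t => f (t, σ t))
          (inner ℝ w (velocity Y (t₁, s₁) + deriv σ t₁ • w)) t₁ :=
        (innerSL ℝ w).hasFDerivAt.comp_hasDerivAt t₁ (hYd.sub_const x₁)
      have h2 : (fun t => f (t, σ t)) =ᶠ[𝓝 t₁] fun _ => 0 := hσf
      exact h1.unique ((hasDerivAt_const t₁ (0 : ℝ)).congr_of_eventuallyEq h2)
    have e : projPerp (τ t₁ x₁) (velocity Y (t₁, s₁)) =
        velocity Y (t₁, s₁) + deriv σ t₁ • w := by
      have h1 : velocity Y (t₁, s₁) + deriv σ t₁ • w ∈ (Submodule.span ℝ {τ t₁ x₁})ᗮ := by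
        rw [Submodule.mem_orthogonal_singleton_iff_inner_right, hτ, inner_smul_left, horth, mul_zero]
      have h2 := Submodule.starProjection_eq_self_iff.2 h1
      rw [← h2, ← projPerp, projPerp_eq_iff, hτ]
      · rw [sub_add_cancel_left, ← neg_smul]
        have h3 : (-deriv σ t₁) • w = (-deriv σ t₁ * ‖w‖) • (‖w‖⁻¹ • w) := by
          rw [smul_smul, mul_assoc, mul_inv_cancel₀ hwn, mul_one]
        rw [h3, cross_smul_self]
      · rw [hτ]; simp [hw0]
    rw [e]
    exact hYd.hasDerivWithinAt

end IsChart

/-- By continuity, x(t) also lies in the neighbourhood belonging to x', so the two points coincide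
for t near t₀. Derivatives within `Ico 0 Te` are unique, also at its left end. -/
theorem HasNormalVelocity.unique {t₀ : ℝ} {x₀ v v' : E3} (ht₀ : t₀ ∈ Ico 0 Te)
    (h : HasNormalVelocity Te ℓ τ t₀ x₀ v) (h' : HasNormalVelocity Te ℓ τ t₀ x₀ v') : v = v' := by
  obtain ⟨x, hx, ⟨U, hU, hxU⟩, hd⟩ := h
  obtain ⟨x', hx', ⟨U', hU', hxU'⟩, hd'⟩ := h'
  have hu : UniqueDiffWithinAt ℝ (Ico 0 Te) t₀ :=
    uniqueDiffOn_Ico 0 Te t₀ ht₀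
  have hc : ∀ᶠ t in 𝓝[Ico 0 Te] t₀, x t ∈ U' := by
    have := hd.continuousWithinAt.tendsto
    rw [hx] at this
    exact this hU'
  have he : x' =ᶠ[𝓝[Ico 0 Te] t₀] x := by
    filter_upwards [hxU, hxU', hc] with t h1 h2 h3
    have h4 : x t ∈ ℓ t ∩ {z | inner ℝ (z - x₀) (τ t₀ x₀) = 0} ∩ U := by rw [h1]; rfl
    have h5 : x t ∈ ({x' t} : Set E3) := by rw [← h2]; exact ⟨h4.1, h3⟩
    exact (mem_singleton_iff.1 h5).symm
  exact hu.eq_deriv _ hd (hd'.congr_of_eventuallyEq he.symm (by rw [hx, hx']))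

theorem IsChart.hasNormalVelocity_projPerp_iff (h : IsChart Ω Te ℓ τ Y J r U) {t₁ s₁ : ℝ}
    (ht₁ : t₁ ∈ J) (htI : t₁ ∈ Ico 0 Te) (hs₁ : s₁ ∈ Icc (-r) r) (hU : Y (t₁, s₁) ∈ U) (a : E3) :
    HasNormalVelocity Te ℓ τ t₁ (Y (t₁, s₁)) (projPerp (τ t₁ (Y (t₁, s₁))) a) ↔
      cross (velocity Y (t₁, s₁) - a) (tangent Y (t₁, s₁)) = 0 := by
  have hw0 := h.tangent_ne_zero ht₁ hs₁
  have hτ := h.tangent_eq t₁ ⟨ht₁, htI⟩ s₁ hs₁ hU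
  have hτ0 : τ t₁ (Y (t₁, s₁)) ≠ 0 := by rw [hτ]; simp [hw0]
  have e : cross (velocity Y (t₁, s₁) - a) (tangent Y (t₁, s₁)) = 0 ↔
      cross (velocity Y (t₁, s₁) - a) (τ t₁ (Y (t₁, s₁))) = 0 := by
    rw [hτ, cross_smul_right, smul_eq_zero, or_iff_right (by simpa using hw0)]
  rw [e, ← projPerp_eq_iff hτ0]
  have hv := h.hasNormalVelocity ht₁ htI hs₁ hU
  exact ⟨fun h' => hv.unique htI h', fun h' => h' ▸ hv⟩

end Chart

/-! ### The weak equation in a chart -/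

section LocalEquation

/-- The field `α̃(τ, τ × Tb)` along a parametrized moving curve. -/
noncomputable def drive (αt : E3 → E3 → E3) (T : ℝ → E3 → Matrix (Fin 3) (Fin 3) ℝ) (b : E3)
    (Y : ℝ × ℝ → E3) (z : ℝ × ℝ) : E3 :=
  αt (‖tangent Y z‖⁻¹ • tangent Y z) (cross (‖tangent Y z‖⁻¹ • tangent Y z) (app (T z.1 (Y z)) b))

/-- The vector `(∂ₜY - α̃(τ, τ × Tb)) × ∂ₛY`, which vanishes where the normal velocity is
the normal part of `α̃(τ, τ × Tb)`. -/
noncomputable def defect (αt : E3 → E3 → E3) (T : ℝ → E3 → Matrix (Fin 3) (Fin 3) ℝ) (b : E3)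
    (Y : ℝ × ℝ → E3) (z : ℝ × ℝ) : E3 :=
  cross (velocity Y z - drive αt T b Y z) (tangent Y z)

theorem hasDerivAt_time {φ : ℝ × E3 → E3} (hφ : ContDiff ℝ ∞ φ) (t : ℝ) (x : E3) :
    HasDerivAt (fun s => φ (s, x)) (fderiv ℝ φ (t, x) (1, 0)) t :=
  (hφ.differentiable (by simp) (t, x)).hasFDerivAt.comp_hasDerivAt t
    ((hasDerivAt_id t).prodMk (hasDerivAt_const t x))

theorem hasFDerivAt_space {φ : ℝ × E3 → E3} (hφ : ContDiff ℝ ∞ φ) (t : ℝ) (x : E3) :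
    HasFDerivAt (fun y => φ (t, y))
      ((fderiv ℝ φ (t, x)).comp (ContinuousLinearMap.inr ℝ ℝ E3)) x :=
  (hφ.differentiable (by simp) (t, x)).hasFDerivAt.comp x (hasFDerivAt_prodMk_right t x)

theorem partialDeriv_slice {φ : ℝ × E3 → E3} (hφ : ContDiff ℝ ∞ φ) (i j : Fin 3) (t : ℝ) (x : E3) :
    partialDeriv (fun y => φ (t, y)) i j x =
      fderiv ℝ φ (t, x) (0, EuclideanSpace.single i 1) j := by
  rw [partialDeriv, (hasFDerivAt_space hφ t x).fderiv]; simp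

theorem continuous_rot_slice {φ : ℝ × E3 → E3} (hφ : ContDiff ℝ ∞ φ) :
    Continuous fun p : ℝ × E3 => rot (fun y => φ (p.1, y)) p.2 := by
  have h : ∀ i j, Continuous fun p : ℝ × E3 => partialDeriv (fun y => φ (p.1, y)) i j p.2 := by
    intro i j
    simp only [partialDeriv_slice hφ]
    have : Continuous fun p : ℝ × E3 => fderiv ℝ φ p (0, EuclideanSpace.single i 1) :=
      (hφ.continuous_fderiv (by simp)).clm_apply continuous_const
    exact (EuclideanSpace.proj j : E3 →L[ℝ] ℝ).continuous.comp this
  refine (PiLp.continuous_toLp 2 _).comp (continuous_pi fun i => ?_)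
  fin_cases i
  · exact (h 1 2).sub (h 2 1)
  · exact (h 2 0).sub (h 0 2)
  · exact (h 0 1).sub (h 1 0)

theorem fderiv_eq_zero_of_notMem_tsupport {φ : ℝ × E3 → E3} {p : ℝ × E3} (hp : p ∉ tsupport φ) :
    fderiv ℝ φ p = 0 := by
  rw [(notMem_tsupport_iff_eventuallyEq.1 hp).fderiv_eq]; simp

theorem rot_slice_eq_zero {φ : ℝ × E3 → E3} (hφ : ContDiff ℝ ∞ φ) {t : ℝ} {x : E3}
    (hp : (t, x) ∉ tsupport φ) : rot (fun y => φ (t, y)) x = 0 := by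
  simp only [rot, partialDeriv_slice hφ, fderiv_eq_zero_of_notMem_tsupport hp]
  apply E3.ext_coord <;> simp

theorem _root_.ContinuousWithinAt.cross {X : Type*} [TopologicalSpace X] {f g : X → E3} {S : Set X}
    {z : X} (hf : ContinuousWithinAt f S z) (hg : ContinuousWithinAt g S z) :
    ContinuousWithinAt (fun y => Dislocation.cross (f y) (g y)) S z :=
  continuous_cross.continuousAt.comp_continuousWithinAt (hf.prodMk hg)

theorem _root_.ContinuousAt.cross {X : Type*} [TopologicalSpace X] {f g : X → E3} {z : X}
    (hf : ContinuousAt f z) (hg : ContinuousAt g z) :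
    ContinuousAt (fun y => Dislocation.cross (f y) (g y)) z :=
  continuous_cross.continuousAt.comp (hf.prodMk hg)

variable {αt : E3 → E3 → E3} {b : E3} {T : ℝ → E3 → Matrix (Fin 3) (Fin 3) ℝ}
  {Ω : Set E3} {Te : ℝ} {ℓ : ℝ → Set E3} {τ : ℝ → E3 → E3}
  {Y : ℝ × ℝ → E3} {J : Set ℝ} {r : ℝ} {U : Set E3}

namespace IsChart

theorem continuousOn_drive (h : IsChart Ω Te ℓ τ Y J r U)
    (hα : ContinuousOn (fun p : E3 × E3 => αt p.1 p.2) (Metric.sphere 0 1 ×ˢ univ))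
    (hT : ContinuousOn (fun p : ℝ × E3 => T p.1 p.2) (Icc 0 Te ×ˢ closure Ω)) :
    ContinuousOn (drive αt T b Y) {z | z.1 ∈ J ∩ Icc 0 Te ∧ z.2 ∈ Icc (-r) r ∧ Y z ∈ U} := by
  have hw := continuous_tangent h.contDiff
  have hne : ∀ z ∈ {z : ℝ × ℝ | z.1 ∈ J ∩ Icc 0 Te ∧ z.2 ∈ Icc (-r) r ∧ Y z ∈ U},
      tangent Y z ≠ 0 := fun z hz => h.tangent_ne_zero hz.1.1 hz.2.1
  have hn : ContinuousOn (fun z => ‖tangent Y z‖⁻¹ • tangent Y z)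
      {z : ℝ × ℝ | z.1 ∈ J ∩ Icc 0 Te ∧ z.2 ∈ Icc (-r) r ∧ Y z ∈ U} :=
    (hw.norm.continuousOn.inv₀ fun z hz => norm_ne_zero_iff.2 (hne z hz)).smul hw.continuousOn
  have hTY : ContinuousOn (fun z : ℝ × ℝ => T z.1 (Y z))
      {z : ℝ × ℝ | z.1 ∈ J ∩ Icc 0 Te ∧ z.2 ∈ Icc (-r) r ∧ Y z ∈ U} :=
    hT.comp (f := fun z : ℝ × ℝ => (z.1, Y z))
      (continuous_fst.prodMk h.contDiff.continuous).continuousOn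
      fun z hz => ⟨hz.1.2, subset_closure (h.subset hz.2.2)⟩
  have hF := continuous_cross.comp_continuousOn
    (hn.prodMk (continuous_app.comp_continuousOn (hTY.prodMk (continuousOn_const (c := b)))))
  refine hα.comp (hn.prodMk hF) fun z hz => ⟨?_, mem_univ _⟩
  rw [mem_sphere_zero_iff_norm, norm_smul, norm_inv, norm_norm,
    inv_mul_cancel₀ (norm_ne_zero_iff.2 (hne z hz))]

theorem continuousAt_drive (h : IsChart Ω Te ℓ τ Y J r U)
    (hα : ContinuousOn (fun p : E3 × E3 => αt p.1 p.2) (Metric.sphere 0 1 ×ˢ univ))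
    (hT : ContinuousOn (fun p : ℝ × E3 => T p.1 p.2) (Icc 0 Te ×ˢ closure Ω)) {z : ℝ × ℝ}
    (hz : z.1 ∈ J ∩ Ioo 0 Te) (hs : z.2 ∈ Icc (-r) r) (hU : Y z ∈ U) :
    ContinuousAt (drive αt T b Y) z := by
  refine (h.continuousOn_drive hα hT).continuousAt ?_
  have h1 := continuousAt_fst.preimage_mem_nhds
    ((h.isOpen_time.inter isOpen_Ioo).mem_nhds hz : J ∩ Ioo 0 Te ∈ 𝓝 z.1)
  have h2 := continuousAt_snd.preimage_mem_nhds
    (isOpen_Ioo.mem_nhds (h.mem_Ioo z.1 hz.1 z.2 hs hU))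
  have h3 := h.contDiff.continuous.continuousAt.preimage_mem_nhds (h.isOpen_space.mem_nhds hU)
  filter_upwards [h1, h2, h3] with y hy1 hy2 hy3
  exact ⟨⟨hy1.1, Ioo_subset_Icc_self hy1.2⟩, Ioo_subset_Icc_self hy2, hy3⟩

theorem continuousAt_defect (h : IsChart Ω Te ℓ τ Y J r U)
    (hα : ContinuousOn (fun p : E3 × E3 => αt p.1 p.2) (Metric.sphere 0 1 ×ˢ univ))
    (hT : ContinuousOn (fun p : ℝ × E3 => T p.1 p.2) (Icc 0 Te ×ˢ closure Ω)) {z : ℝ × ℝ}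
    (hz : z.1 ∈ J ∩ Ioo 0 Te) (hs : z.2 ∈ Icc (-r) r) (hU : Y z ∈ U) :
    ContinuousAt (defect αt T b Y) z :=
  ((continuous_velocity h.contDiff).continuousAt.sub
    (h.continuousAt_drive hα hT hz hs hU)).cross (continuous_tangent h.contDiff).continuousAt

/-- Integrals over the curve of functions supported in a chart. -/
theorem integral_curveMeasure (h : IsChart Ω Te ℓ τ Y J r U) {t : ℝ} (ht : t ∈ J ∩ Ico 0 Te)
    (b : E3) {f : E3 → ℝ} (hf : ∀ x ∉ U, f x = 0) {g : ℝ → ℝ} (hg : ContinuousOn g (Icc (-r) r))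
    (hfg : ∀ s ∈ Icc (-r) r, ‖tangent Y (t, s)‖ * f (Y (t, s)) = g s) :
    Integrable f (curveMeasure b (ℓ t)) ∧
      ∫ x, f x ∂(curveMeasure b (ℓ t)) = ‖b‖ * ∫ s in Icc (-r) r, g s := by
  set ν : Measure E3 := Measure.hausdorffMeasure 1
  have hγ := contDiff_slice h.contDiff t
  have hUm := h.isOpen_space.measurableSet
  have hres : (ν.restrict (ℓ t)).restrict U =
      (ν.restrict ((fun s => Y (t, s)) '' Icc (-r) r)).restrict U := by
    rw [Measure.restrict_restrict hUm, Measure.restrict_restrict hUm, inter_comm, h.image_eq t ht,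
      inter_comm]
  have hsupp : Function.support f ⊆ U := fun x hx => by
    by_contra hxU
    exact hx (hf x hxU)
  have hcongr : ∀ s ∈ Icc (-r) r,
      ‖deriv (fun σ => Y (t, σ)) s‖ * f ((fun σ => Y (t, σ)) s) = g s := fun s hs => by
    rw [deriv_eq_tangent h.contDiff]; exact hfg s hs
  constructor
  · refine Integrable.smul_measure ?_ ENNReal.ofReal_ne_top
    rw [← integrableOn_iff_integrable_of_support_subset hsupp, IntegrableOn, hres, ← IntegrableOn,
      integrableOn_iff_integrable_of_support_subset hsupp]
    refine (integrableOn_image_iff_norm_deriv_smul hγ (h.injOn ht.1) f).2 ?_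
    exact (hg.integrableOn_compact isCompact_Icc).congr_fun (fun s hs => (hcongr s hs).symm)
      measurableSet_Icc
  · rw [curveMeasure, integral_smul_measure, ENNReal.toReal_ofReal (norm_nonneg _), smul_eq_mul,
      ← setIntegral_eq_integral_of_forall_compl_eq_zero hf, hres,
      setIntegral_eq_integral_of_forall_compl_eq_zero hf,
      integral_image_eq_integral_norm_deriv_smul hγ (h.injOn ht.1) f,
      setIntegral_congr_fun measurableSet_Icc hcongr]

/-- Time integrals of pairings supported in a chart. -/
theorem integral_pairing (h : IsChart Ω Te ℓ τ Y J r U) (b : E3) {K : Set (ℝ × E3)}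
    (hK : K ⊆ (J ∩ Ioo 0 Te) ×ˢ U) {β ζ : ℝ → E3 → E3} (hζ : ∀ t x, (t, x) ∉ K → ζ t x = 0)
    {G : ℝ × ℝ → ℝ} (hG : ContinuousOn G (univ ×ˢ Icc (-r) r))
    (hG0 : ∀ z : ℝ × ℝ, (z.1, Y z) ∉ K → G z = 0)
    (hβG : ∀ t ∈ J ∩ Ioo 0 Te, ∀ s ∈ Icc (-r) r, Y (t, s) ∈ U →
      ‖tangent Y (t, s)‖ * inner ℝ (β t (Y (t, s))) (ζ t (Y (t, s))) = G (t, s)) :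
    (∀ t ∈ Ioo 0 Te, Integrable (fun x => inner ℝ (β t x) (ζ t x)) (curveMeasure b (ℓ t))) ∧
    IntegrableOn (fun t => pairing (curveMeasure b (ℓ t)) (β t) (ζ t)) (Ioo 0 Te) ∧
    IntegrableOn G (Ioo 0 Te ×ˢ Icc (-r) r) ∧
    ∫ t in Ioo 0 Te, pairing (curveMeasure b (ℓ t)) (β t) (ζ t) =
      ‖b‖ * ∫ z in Ioo 0 Te ×ˢ Icc (-r) r, G z := by
  have key : ∀ t ∈ Ioo 0 Te,
      Integrable (fun x => inner ℝ (β t x) (ζ t x)) (curveMeasure b (ℓ t)) ∧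
      pairing (curveMeasure b (ℓ t)) (β t) (ζ t) = ‖b‖ * ∫ s in Icc (-r) r, G (t, s) := by
    intro t ht
    by_cases htJ : t ∈ J
    · refine h.integral_curveMeasure ⟨htJ, Ioo_subset_Ico_self ht⟩ b (fun x hx => ?_)
        (g := fun s => G (t, s)) ?_ fun s hs => ?_
      · rw [hζ t x fun hk => hx (hK hk).2, inner_zero_right]
      · exact hG.comp (by fun_prop) fun s hs => ⟨mem_univ _, hs⟩
      · by_cases hU : Y (t, s) ∈ U
        · exact hβG t ⟨htJ, ht⟩ s hs hU
        · rw [hζ t _ fun hk => hU (hK hk).2, hG0 (t, s) fun hk => hU (hK hk).2]; simp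
    · have h1 : ∀ x, ζ t x = 0 := fun x => hζ t x fun hk => htJ (hK hk).1.1
      have h2 : ∀ s, G (t, s) = 0 := fun s => hG0 (t, s) fun hk => htJ (hK hk).1.1
      simp [pairing, h1, h2]
  have hGi : IntegrableOn G (Ioo 0 Te ×ˢ Icc (-r) r) :=
    ((hG.mono (prod_mono (subset_univ (Icc 0 Te)) Subset.rfl)).integrableOn_compact
      (isCompact_Icc.prod isCompact_Icc)).mono_set (prod_mono Ioo_subset_Icc_self Subset.rfl)
  have hGp : Integrable G ((volume.restrict (Ioo 0 Te)).prod (volume.restrict (Icc (-r) r))) := by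
    rw [Measure.prod_restrict, ← Measure.volume_eq_prod]; exact hGi
  refine ⟨fun t ht => (key t ht).1, ?_, hGi, ?_⟩
  · exact IntegrableOn.congr_fun (hGp.integral_prod_left.const_mul ‖b‖)
      (fun t ht => (key t ht).2.symm) measurableSet_Ioo
  · rw [setIntegral_congr_fun measurableSet_Ioo fun t ht => (key t ht).2, integral_const_mul,
      Measure.volume_eq_prod, setIntegral_prod _ hGi]

/-- The transport identity: in the sense of distributions, `∂ₜρ = rot (∂ₜY × ρ)`. -/
theorem integral_transport_eq_zero (h : IsChart Ω Te ℓ τ Y J r U) {φ : ℝ × E3 → E3}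
    (hφ : ContDiff ℝ ∞ φ) (hφc : HasCompactSupport φ) (hφs : tsupport φ ⊆ (J ∩ Ioo 0 Te) ×ˢ U) :
    ∫ z in Ioo 0 Te ×ˢ Icc (-r) r, (inner ℝ (tangent Y z) (fderiv ℝ φ (z.1, Y z) (1, 0)) +
      inner ℝ (rot (fun x => φ (z.1, x)) (Y z)) (cross (velocity Y z) (tangent Y z))) = 0 := by
  classical
  have hg : Continuous fun z : ℝ × ℝ => (z.1, Y z) :=
    continuous_fst.prodMk h.contDiff.continuous
  set A : Set (ℝ × ℝ) := {z | (z.1, Y z) ∈ tsupport φ ∧ z.2 ∈ Icc (-r) r} with hA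
  have hAclosed : IsClosed A :=
    ((isClosed_tsupport φ).preimage hg).inter (isClosed_Icc.preimage continuous_snd)
  have hAcomp : IsCompact A :=
    ((hφc.image continuous_fst).prod isCompact_Icc).of_isClosed_subset hAclosed
      fun z hz => ⟨⟨_, hz.1, rfl⟩, hz.2⟩
  have hAIoo : ∀ z ∈ A, z.2 ∈ Ioo (-r) r := fun z hz =>
    h.mem_Ioo z.1 (hφs hz.1).1.1 z.2 hz.2 (hφs hz.1).2
  set Φ : ℝ × ℝ → E3 := fun z => φ (z.1, Y z) with hΦ
  have hΦd : ContDiff ℝ 1 Φ := (hφ.of_le (by simp)).comp (contDiff_fst.prodMk h.contDiff)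
  -- `Y` is defined on the whole plane and may re-enter the support of φ outside the chart, hence
  -- the cut-off in s. It keeps ψ of class C¹, since the support meets the parameter interval only
  -- in its interior (`mem_Ioo`).
  set ψ : ℝ × ℝ → E3 := fun z => if z.2 ∈ Ioo (-r) r then Φ z else 0 with hψ
  have hψA : ∀ z ∉ A, ψ z = 0 := by
    intro z hz
    simp only [hψ]
    split_ifs with hz2
    · exact image_eq_zero_of_notMem_tsupport (f := φ) (x := (z.1, Y z)) fun hk => hz ⟨hk, Ioo_subset_Icc_self hz2⟩
    · rfl
  have hψin : ∀ z ∈ A, ψ =ᶠ[𝓝 z] Φ := by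
    intro z hz
    filter_upwards [(isOpen_Ioo.preimage continuous_snd).mem_nhds (hAIoo z hz)] with y hy
    exact if_pos hy
  have hψout : ∀ z ∉ A, ψ =ᶠ[𝓝 z] fun _ => 0 := by
    intro z hz
    filter_upwards [hAclosed.isOpen_compl.mem_nhds hz] with y hy
    exact hψA y hy
  have hψd : ContDiff ℝ 1 ψ := by
    rw [contDiff_iff_contDiffAt]
    intro z
    by_cases hz : z ∈ A
    · exact hΦd.contDiffAt.congr_of_eventuallyEq (hψin z hz)
    · exact contDiffAt_const.congr_of_eventuallyEq (hψout z hz)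
  have hψc : HasCompactSupport ψ := HasCompactSupport.intro hAcomp hψA
  have key := integral_inner_fderiv_sub_eq_zero h.contDiff hψd hψc (0, 1) (1, 0)
  refine Eq.trans ?_ key
  rw [← integral_indicator (measurableSet_Ioo.prod measurableSet_Icc)]
  congr with z
  by_cases hz : z ∈ A
  · have hmem : z ∈ Ioo 0 Te ×ˢ Icc (-r) r := ⟨(hφs hz.1).1.2, hz.2⟩
    have hΦf : ∀ v, fderiv ℝ Φ z v = fderiv ℝ φ (z.1, Y z) (v.1, fderiv ℝ Y z v) := by
      intro v
      have h1 := ((hφ.differentiable (by simp) (z.1, Y z)).hasFDerivAt.comp z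
        (hasFDerivAt_fst.prodMk (h.contDiff.differentiable one_ne_zero z).hasFDerivAt)).fderiv
      exact congrArg (fun L => L v) h1
    have hsp : ∀ a, fderiv ℝ (fun x => φ (z.1, x)) (Y z) a = fderiv ℝ φ (z.1, Y z) (0, a) := by
      intro a
      rw [(hasFDerivAt_space hφ z.1 (Y z)).fderiv]; rfl
    rw [indicator_of_mem hmem, (hψin z hz).fderiv_eq, hΦf, hΦf, inner_rot_cross, hsp, hsp]
    -- The time derivative of ψ has an explicit part and a transported part. The latter, with the
    -- s-derivative, forms the antisymmetric expression of `inner_rot_cross`.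
    have e : fderiv ℝ φ (z.1, Y z) ((1 : ℝ), fderiv ℝ Y z (1, 0)) =
        fderiv ℝ φ (z.1, Y z) (1, 0) + fderiv ℝ φ (z.1, Y z) (0, velocity Y z) := by
      rw [← map_add]; simp [velocity]
    simp only [e, inner_add_right]
    simp only [tangent, velocity]
    ring
  · rw [(hψout z hz).fderiv_eq]
    by_cases hmem : z ∈ Ioo 0 Te ×ˢ Icc (-r) r
    · have hk : (z.1, Y z) ∉ tsupport φ := fun hk => hz ⟨hk, hmem.2⟩
      rw [indicator_of_mem hmem, fderiv_eq_zero_of_notMem_tsupport hk, rot_slice_eq_zero hφ hk]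
      simp
    · rw [indicator_of_notMem hmem]; simp

end IsChart

/-- All integrals occurring in the weak formulation exist for the test field `φ`. -/
structure HasTestIntegrals (Te : ℝ) (αt : E3 → E3 → E3)
    (T : ℝ → E3 → Matrix (Fin 3) (Fin 3) ℝ) (b : E3) (μ : ℝ → Measure E3) (τ : ℝ → E3 → E3)
    (φ : ℝ × E3 → E3) : Prop where
  integrable_left : ∀ t ∈ Ioo 0 Te,
    Integrable (fun x => inner ℝ (τ t x) (deriv (fun s => φ (s, x)) t)) (μ t)
  integrable_right : ∀ t ∈ Ioo 0 Te,
    Integrable (fun x => inner ℝ (alphaDensity αt (T t) (τ t) b x) (rot (fun x => φ (t, x)) x)) (μ t)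
  integrableOn_left :
    IntegrableOn (fun t => pairing (μ t) (τ t) (fun x => deriv (fun s => φ (s, x)) t)) (Ioo 0 Te)
  integrableOn_right : IntegrableOn
    (fun t => pairing (μ t) (alphaDensity αt (T t) (τ t) b) (rot (fun x => φ (t, x)))) (Ioo 0 Te)

/-- The residual of the weak equation for test fields supported in a chart. -/
theorem IsChart.weak_residual (h : IsChart Ω Te ℓ τ Y J r U)
    (hα : ContinuousOn (fun p : E3 × E3 => αt p.1 p.2) (Metric.sphere 0 1 ×ˢ univ))
    (hT : ContinuousOn (fun p : ℝ × E3 => T p.1 p.2) (Icc 0 Te ×ˢ closure Ω)) (b : E3)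
    {φ : ℝ × E3 → E3} (hφ : ContDiff ℝ ∞ φ) (hφc : HasCompactSupport φ)
    (hφs : tsupport φ ⊆ (J ∩ Ioo 0 Te) ×ˢ U) :
    HasTestIntegrals Te αt T b (fun t => curveMeasure b (ℓ t)) τ φ ∧
    IntegrableOn (fun z => inner ℝ (rot (fun x => φ (z.1, x)) (Y z)) (defect αt T b Y z))
      (Ioo 0 Te ×ˢ Icc (-r) r) ∧
    (∫ t in Ioo 0 Te, pairing (curveMeasure b (ℓ t)) (τ t)
        (fun x => deriv (fun s => φ (s, x)) t)) +
      ∫ t in Ioo 0 Te, pairing (curveMeasure b (ℓ t)) (alphaDensity αt (T t) (τ t) b)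
        (rot (fun x => φ (t, x))) =
      -(‖b‖ * ∫ z in Ioo 0 Te ×ˢ Icc (-r) r,
        inner ℝ (rot (fun x => φ (z.1, x)) (Y z)) (defect αt T b Y z)) := by
  have hg : Continuous fun z : ℝ × ℝ => (z.1, Y z) :=
    continuous_fst.prodMk h.contDiff.continuous
  have hw := continuous_tangent h.contDiff
  have hne : ∀ {t s : ℝ}, t ∈ J → s ∈ Icc (-r) r → ‖tangent Y (t, s)‖ ≠ 0 := fun ht hs =>
    norm_ne_zero_iff.2 (h.tangent_ne_zero ht hs)
  have hrot : Continuous fun z : ℝ × ℝ => rot (fun x => φ (z.1, x)) (Y z) :=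
    (continuous_rot_slice hφ).comp hg
  obtain ⟨a1, a2, a3, a4⟩ := h.integral_pairing b hφs (β := τ)
    (ζ := fun t x => deriv (fun s => φ (s, x)) t)
    (G := fun z => inner ℝ (tangent Y z) (fderiv ℝ φ (z.1, Y z) (1, 0)))
    (fun t x hk => by
      rw [(hasDerivAt_time hφ t x).deriv, fderiv_eq_zero_of_notMem_tsupport hk]; rfl)
    (hw.inner (((hφ.continuous_fderiv (by simp)).comp hg).clm_apply
      continuous_const)).continuousOn
    (fun z hk => by rw [fderiv_eq_zero_of_notMem_tsupport hk]; simp)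
    (fun t ht s hs hU => by
      rw [h.tangent_eq t ⟨ht.1, Ioo_subset_Ico_self ht.2⟩ s hs hU, (hasDerivAt_time hφ t _).deriv,
        inner_smul_left, ← mul_assoc]
      simp [mul_inv_cancel₀ (hne ht.1 hs)])
  obtain ⟨b1, b2, b3, b4⟩ := h.integral_pairing b hφs
    (β := fun t => alphaDensity αt (T t) (τ t) b) (ζ := fun t => rot (fun x => φ (t, x)))
    (G := fun z => inner ℝ (cross (drive αt T b Y z) (tangent Y z)) (rot (fun x => φ (z.1, x)) (Y z)))
    (fun t x hk => rot_slice_eq_zero hφ hk)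
    -- `drive` is known to be continuous only inside the chart and at times in (0, Te). Off the
    -- preimage of the support of φ the product vanishes locally, so continuity there is trivial.
    (fun z hz => by
      refine ContinuousAt.continuousWithinAt ?_
      by_cases hk : (z.1, Y z) ∈ tsupport φ
      · have hd := h.continuousAt_drive (b := b) hα hT (hφs hk).1 hz.2 (hφs hk).2
        exact (hd.cross hw.continuousAt).inner hrot.continuousAt
      · have h0 : ContinuousAt (fun _ : ℝ × ℝ => (0 : ℝ)) z := continuousAt_const
        refine h0.congr ?_
        filter_upwards [((isClosed_tsupport φ).preimage hg).isOpen_compl.mem_nhds hk] with y hy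
        rw [rot_slice_eq_zero hφ hy, inner_zero_right])
    (fun z hk => by rw [rot_slice_eq_zero hφ hk, inner_zero_right])
    (fun t ht s hs hU => by
      have e := h.tangent_eq t ⟨ht.1, Ioo_subset_Ico_self ht.2⟩ s hs hU
      have e2 : alphaDensity αt (T t) (τ t) b (Y (t, s)) =
          ‖tangent Y (t, s)‖⁻¹ • cross (drive αt T b Y (t, s)) (tangent Y (t, s)) := by
        rw [alphaDensity, e, cross_smul_right]; rfl
      rw [e2, inner_smul_left, ← mul_assoc]
      simp [mul_inv_cancel₀ (hne ht.1 hs)])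
  have hcont3 : Continuous fun z : ℝ × ℝ => inner ℝ (rot (fun x => φ (z.1, x)) (Y z))
      (cross (velocity Y z) (tangent Y z)) :=
    hrot.inner (continuous_cross.comp ((continuous_velocity h.contDiff).prodMk hw))
  have c3 : IntegrableOn (fun z : ℝ × ℝ => inner ℝ (rot (fun x => φ (z.1, x)) (Y z))
      (cross (velocity Y z) (tangent Y z))) (Ioo 0 Te ×ˢ Icc (-r) r) :=
    (hcont3.continuousOn.integrableOn_compact (isCompact_Icc.prod isCompact_Icc)).mono_set
      (prod_mono Ioo_subset_Icc_self Subset.rfl)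
  have htr := h.integral_transport_eq_zero hφ hφc hφs
  rw [integral_add a3 c3] at htr
  have hH : (fun z => inner ℝ (rot (fun x => φ (z.1, x)) (Y z)) (defect αt T b Y z)) =
      fun z => inner ℝ (rot (fun x => φ (z.1, x)) (Y z)) (cross (velocity Y z) (tangent Y z)) -
        inner ℝ (cross (drive αt T b Y z) (tangent Y z)) (rot (fun x => φ (z.1, x)) (Y z)) := by
    funext z
    rw [defect, cross_sub_left, inner_sub_right, real_inner_comm (cross (drive αt T b Y z) _)]
  refine ⟨⟨a1, b1, a2, b2⟩, ?_, ?_⟩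
  · rw [hH]; exact c3.sub b3
  · rw [a4, b4, hH, integral_sub c3 b3]
    linear_combination ‖b‖ * htr

end LocalEquation

/-! ### From the weak equation to the normal velocity -/

section Necessity

theorem inner_cross_self_right (a w : E3) : inner ℝ w (cross a w) = 0 := by
  simp only [inner_eq_sum, cross_apply_zero, cross_apply_one, cross_apply_two]; ring

theorem cross_cross_self {w m : E3} (h : inner ℝ w m = 0) :
    cross (cross w m) w = (inner ℝ w w : ℝ) • m := by
  rw [inner_eq_sum] at h
  apply E3.ext_coord <;>
  simp only [PiLp.smul_apply, smul_eq_mul, inner_eq_sum, cross_apply_zero, cross_apply_one,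
    cross_apply_two]
  · linear_combination -w 0 * h
  · linear_combination -w 1 * h
  · linear_combination -w 2 * h

/-- The pairing of the rotation of `x ↦ B (⟨x - x₁, w₁⟩) ⟨n, x - x₁⟩ w₁` with cross products. -/
theorem inner_rot_cross_of_eventuallyEq {φ : E3 → E3} {B : ℝ → ℝ} {n w₁ x₁ x : E3}
    (hB : Differentiable ℝ B)
    (hφ : φ =ᶠ[𝓝 x] fun y => (B (inner ℝ w₁ (y - x₁)) * inner ℝ n (y - x₁)) • w₁) (a w : E3) :
    inner ℝ (rot φ x) (cross a w) =
      B (inner ℝ w₁ (x - x₁)) * inner ℝ (cross n w₁) (cross a w) := by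
  have hin : ∀ v : E3, HasFDerivAt (fun y => inner ℝ v (y - x₁)) (innerSL ℝ v) x := fun v =>
    (innerSL ℝ v).hasFDerivAt.comp x ((hasFDerivAt_id x).sub_const x₁)
  have h1 : HasFDerivAt (fun y => B (inner ℝ w₁ (y - x₁)))
      (deriv B (inner ℝ w₁ (x - x₁)) • innerSL ℝ w₁) x :=
    (hB _).hasDerivAt.comp_hasFDerivAt x (hin w₁)
  have h2 := ((h1.mul (hin n)).smul_const w₁).congr_of_eventuallyEq hφ
  -- The derivative of `B` contributes a term symmetric in a and w, because both the gradient and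
  -- the field point along w₁; it cancels.
  rw [inner_rot_cross, h2.fderiv, inner_cross_cross]
  simp only [ContinuousLinearMap.smulRight_apply, add_apply,
    smul_apply, innerSL_apply_apply, smul_eq_mul, inner_smul_right]
  rw [real_inner_comm w₁ w, real_inner_comm w₁ a]
  ring

variable {αt : E3 → E3 → E3} {b : E3} {T : ℝ → E3 → Matrix (Fin 3) (Fin 3) ℝ}
  {Ω : Set E3} {Te : ℝ} {ℓ : ℝ → Set E3} {τ : ℝ → E3 → E3}
  {Y : ℝ × ℝ → E3} {J : Set ℝ} {r : ℝ} {U : Set E3}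

/-- The height w₁ · (Y - x₁) serves as a local coordinate along the curve: by strict monotonicity
only s₁ has height 0 at time t₁, and by compactness small heights at nearby times force s close to
s₁. -/
theorem IsChart.eventually_of_inner_eq (h : IsChart Ω Te ℓ τ Y J r U) {t₁ s₁ : ℝ} (ht₁ : t₁ ∈ J)
    (hs₁ : s₁ ∈ Icc (-r) r) {P : ℝ × ℝ → Prop} (hP : ∀ᶠ z in 𝓝 (t₁, s₁), P z) :
    ∀ᶠ q : ℝ × ℝ in 𝓝 (t₁, 0), ∀ s ∈ Icc (-r) r,
      inner ℝ (tangent Y (t₁, s₁)) (Y (q.1, s) - Y (t₁, s₁)) = q.2 → P (q.1, s) := by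
  refine isCompact_Icc.eventually_forall_of_forall_eventually fun s hs => ?_
  rcases eq_or_ne s s₁ with rfl | hne
  · have hc : Tendsto (fun p : (ℝ × ℝ) × ℝ => (p.1.1, p.2)) (𝓝 ((t₁, 0), s)) (𝓝 (t₁, s)) :=
      Continuous.tendsto (by fun_prop) _
    filter_upwards [hc.eventually hP] with p hp _ using hp
  · have hc1 : Continuous fun p : (ℝ × ℝ) × ℝ =>
        inner ℝ (tangent Y (t₁, s₁)) (Y (p.1.1, p.2) - Y (t₁, s₁)) :=
      continuous_const.inner ((h.contDiff.continuous.comp (by fun_prop)).sub continuous_const)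
    have hc2 : Continuous fun p : (ℝ × ℝ) × ℝ => p.1.2 := by fun_prop
    have hne' : inner ℝ (tangent Y (t₁, s₁)) (Y (t₁, s) - Y (t₁, s₁)) ≠ 0 := by
      intro h0
      refine hne ((h.strictMonoOn_inner ht₁ ht₁ hs₁ (Y (t₁, s₁))).injOn hs hs₁ ?_)
      simp only [sub_self, inner_zero_left]
      rw [real_inner_comm]; exact h0
    filter_upwards [(isOpen_ne_fun hc1 hc2).mem_nhds hne'] with p hp hp'
    exact absurd hp' hp

/-- Suppose m₁ ≠ 0. A cut-off in time and height, times (n · (x - x₁)) w₁ with n = w₁ × m₁, has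
rotation |w₁|² m₁ times the cut-off when paired with the defect on the curve. Near (t₁, s₁) the
defect has positive product with m₁, so the residual cannot vanish. -/
theorem IsChart.defect_eq_zero (h : IsChart Ω Te ℓ τ Y J r U)
    (hα : ContinuousOn (fun p : E3 × E3 => αt p.1 p.2) (Metric.sphere 0 1 ×ˢ univ))
    (hT : ContinuousOn (fun p : ℝ × E3 => T p.1 p.2) (Icc 0 Te ×ˢ closure Ω)) (hb : b ≠ 0)
    (hweak : IsWeakSolution Ω Te αt T b (fun t => curveMeasure b (ℓ t)) τ) {t₁ s₁ : ℝ}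
    (ht₁ : t₁ ∈ J ∩ Ioo 0 Te) (hs₁ : s₁ ∈ Icc (-r) r) (hU : Y (t₁, s₁) ∈ U) :
    defect αt T b Y (t₁, s₁) = 0 := by
  by_contra hm0
  set x₁ := Y (t₁, s₁) with hx₁
  set w₁ := tangent Y (t₁, s₁) with hw₁
  set m₁ := defect αt T b Y (t₁, s₁) with hm₁
  have hw0 : w₁ ≠ 0 := h.tangent_ne_zero ht₁.1 hs₁
  have hwm : inner ℝ w₁ m₁ = 0 := inner_cross_self_right _ _
  set n := cross w₁ m₁ with hn
  have hnw : cross n w₁ = (inner ℝ w₁ w₁ : ℝ) • m₁ := cross_cross_self hwm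
  have hww : 0 < (inner ℝ w₁ w₁ : ℝ) := real_inner_self_pos.2 hw0
  obtain ⟨ρ', hρ', hball⟩ := Metric.isOpen_iff.1 h.isOpen_space x₁ hU
  have hdc : ContinuousAt (defect αt T b Y) (t₁, s₁) := h.continuousAt_defect hα hT ht₁ hs₁ hU
  have hpos : ∀ᶠ z in 𝓝 (t₁, s₁), 0 < inner ℝ m₁ (defect αt T b Y z) :=
    (continuousAt_const.inner hdc).eventually_const_lt (real_inner_self_pos.2 hm0)
  have hYb : ∀ᶠ z in 𝓝 (t₁, s₁), Y z ∈ Metric.ball x₁ (ρ' / 4) :=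
    h.contDiff.continuous.continuousAt.eventually (Metric.ball_mem_nhds _ (by positivity))
  have hev := h.eventually_of_inner_eq ht₁.1 hs₁ (hpos.and hYb)
  have hevt : ∀ᶠ q : ℝ × ℝ in 𝓝 (t₁, 0), q.1 ∈ J ∩ Ioo 0 Te :=
    continuousAt_fst.eventually ((h.isOpen_time.inter isOpen_Ioo).mem_nhds ht₁)
  obtain ⟨ε, hε, hεq⟩ := Metric.nhds_basis_closedBall.eventually_iff.1 (hev.and hevt)
  -- θ only confines the support to U. It is 1 on the ball of radius ρ'/4 that contains the relevant
  -- piece of the curve, so its gradient never enters; β depends on position through the height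
  -- alone.
  let θ : ContDiffBump x₁ := ⟨ρ' / 4, ρ' / 2, by positivity, by linarith⟩
  let β : ContDiffBump ((t₁, 0) : ℝ × ℝ) := ⟨ε / 2, ε, by positivity, by linarith⟩
  set φ : ℝ × E3 → E3 := fun p =>
    (β (p.1, inner ℝ w₁ (p.2 - x₁)) * θ p.2 * inner ℝ n (p.2 - x₁)) • w₁ with hφ
  have hqd : ContDiff ℝ ∞ fun p : ℝ × E3 => (p.1, (inner ℝ w₁ (p.2 - x₁) : ℝ)) :=
    contDiff_fst.prodMk (contDiff_const.inner ℝ (contDiff_snd.sub contDiff_const))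
  have hφd : ContDiff ℝ ∞ φ :=
    (((β.contDiff.comp hqd).mul (θ.contDiff.comp contDiff_snd)).mul
      (contDiff_const.inner ℝ (contDiff_snd.sub contDiff_const))).smul contDiff_const
  set C : Set (ℝ × E3) := {p | (p.1, (inner ℝ w₁ (p.2 - x₁) : ℝ)) ∈ Metric.closedBall (t₁, 0) ε ∧
    p.2 ∈ Metric.closedBall x₁ (ρ' / 2)} with hC
  have hCclosed : IsClosed C :=
    (Metric.isClosed_closedBall.preimage hqd.continuous).inter
      (Metric.isClosed_closedBall.preimage continuous_snd)
  have hCcomp : IsCompact C := by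
    refine ((isCompact_closedBall t₁ ε).prod (isCompact_closedBall x₁ (ρ' / 2))).of_isClosed_subset
      hCclosed fun p hp => ⟨?_, hp.2⟩
    have := hp.1
    rw [← closedBall_prod_same] at this
    exact this.1
  have hβ0 : ∀ q ∉ Metric.closedBall ((t₁, 0) : ℝ × ℝ) ε, β q = 0 := fun q hq =>
    β.zero_of_le_dist (not_le.1 hq).le
  have hφC : ∀ p ∉ C, φ p = 0 := by
    intro p hp
    by_cases hp1 : (p.1, (inner ℝ w₁ (p.2 - x₁) : ℝ)) ∈ Metric.closedBall (t₁, 0) ε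
    · have : θ p.2 = 0 := θ.zero_of_le_dist (not_le.1 fun hle => hp ⟨hp1, hle⟩).le
      simp [hφ, this]
    · simp [hφ, hβ0 _ hp1]
  have hφc : HasCompactSupport φ := HasCompactSupport.intro hCcomp hφC
  have hφsC : tsupport φ ⊆ C :=
    closure_minimal (fun p hp => by_contra fun hpC => hp (hφC p hpC)) hCclosed
  have hφs : tsupport φ ⊆ (J ∩ Ioo 0 Te) ×ˢ U := fun p hp =>
    ⟨(hεq (hφsC hp).1).2, hball (Metric.closedBall_subset_ball (by linarith) (hφsC hp).2)⟩
  obtain ⟨-, hHi, hres⟩ := h.weak_residual hα hT b hφd hφc hφs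
  obtain ⟨-, -, heq⟩ := hweak φ hφd hφc
    (hφs.trans (prod_mono inter_subset_right h.subset))
  have hH0 : ∫ z in Ioo 0 Te ×ˢ Icc (-r) r,
      inner ℝ (rot (fun x => φ (z.1, x)) (Y z)) (defect αt T b Y z) = 0 := by
    rw [← heq, add_neg_cancel] at hres
    have := neg_eq_zero.1 hres.symm
    exact (mul_eq_zero.1 this).resolve_left (norm_ne_zero_iff.2 hb)
  have hHval : ∀ z ∈ Ioo 0 Te ×ˢ Icc (-r) r,
      inner ℝ (rot (fun x => φ (z.1, x)) (Y z)) (defect αt T b Y z) =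
        β (z.1, inner ℝ w₁ (Y z - x₁)) * (inner ℝ w₁ w₁ * inner ℝ m₁ (defect αt T b Y z)) ∧
      ((z.1, (inner ℝ w₁ (Y z - x₁) : ℝ)) ∈ Metric.closedBall (t₁, 0) ε →
        0 < inner ℝ m₁ (defect αt T b Y z)) := by
    intro z hz
    by_cases hq : (z.1, (inner ℝ w₁ (Y z - x₁) : ℝ)) ∈ Metric.closedBall (t₁, 0) ε
    · obtain ⟨hp1, hp2⟩ := (hεq hq).1 z.2 hz.2 rfl
      refine ⟨?_, fun _ => hp1⟩
      -- A curve point with height and time in the ball lies where θ = 1, so φ agrees nearby with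
      -- the field without θ.
      have hθ : (fun x => φ (z.1, x)) =ᶠ[𝓝 (Y z)]
          fun y => ((fun u => β (z.1, u)) (inner ℝ w₁ (y - x₁)) * inner ℝ n (y - x₁)) • w₁ := by
        filter_upwards [θ.eventuallyEq_one_of_mem_ball hp2] with y hy
        simp only [hφ, hy, Pi.one_apply, mul_one]
      have hB : Differentiable ℝ fun u : ℝ => β (z.1, u) :=
        (β.contDiff (n := 1)).differentiable one_ne_zero |>.comp (by fun_prop)
      have := inner_rot_cross_of_eventuallyEq hB hθ
        (velocity Y z - drive αt T b Y z) (tangent Y z)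
      rw [hnw, inner_smul_left] at this
      exact this
    · refine ⟨?_, fun hq' => absurd hq' hq⟩
      rw [hβ0 _ hq, zero_mul, rot_slice_eq_zero hφd fun hk => hq (hφsC hk).1, inner_zero_left]
  have hnonneg : ∀ z ∈ Ioo 0 Te ×ˢ Icc (-r) r,
      0 ≤ inner ℝ (rot (fun x => φ (z.1, x)) (Y z)) (defect αt T b Y z) := by
    intro z hz
    rw [(hHval z hz).1]
    by_cases hq : (z.1, (inner ℝ w₁ (Y z - x₁) : ℝ)) ∈ Metric.closedBall (t₁, 0) ε
    · exact mul_nonneg β.nonneg (mul_nonneg hww.le ((hHval z hz).2 hq).le)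
    · rw [hβ0 _ hq, zero_mul]
  have hmeas : MeasurableSet (Ioo 0 Te ×ˢ Icc (-r) r) := measurableSet_Ioo.prod measurableSet_Icc
  have hpos' := (setIntegral_pos_iff_support_of_nonneg_ae
    ((ae_restrict_iff' hmeas).2 (Eventually.of_forall hnonneg)) hHi).2 ?_
  · exact hpos'.ne' hH0
  · refine Measure.measure_pos_of_mem_nhds (x := (t₁, s₁)) volume ?_
    have hq : ContinuousAt (fun z : ℝ × ℝ => (z.1, (inner ℝ w₁ (Y z - x₁) : ℝ))) (t₁, s₁) :=
      (hqd.continuous.comp (continuous_fst.prodMk h.contDiff.continuous)).continuousAt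
    have hq1 : (((t₁, s₁) : ℝ × ℝ).1, (inner ℝ w₁ (Y (t₁, s₁) - x₁) : ℝ)) = (t₁, 0) := by
      simp [← hx₁]
    have hqb : ∀ᶠ z in 𝓝 (t₁, s₁),
        (z.1, (inner ℝ w₁ (Y z - x₁) : ℝ)) ∈ Metric.ball ((t₁, 0) : ℝ × ℝ) ε :=
      hq.eventually (by beta_reduce; rw [hq1]; exact Metric.ball_mem_nhds _ hε)
    have hz : ∀ᶠ z : ℝ × ℝ in 𝓝 (t₁, s₁), z ∈ Ioo 0 Te ×ˢ Ioo (-r) r :=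
      (isOpen_Ioo.prod isOpen_Ioo).mem_nhds ⟨ht₁.2, h.mem_Ioo t₁ ht₁.1 s₁ hs₁ hU⟩
    filter_upwards [hqb, hz] with z hz1 hz2
    have hz2' : z ∈ Ioo 0 Te ×ˢ Icc (-r) r := ⟨hz2.1, Ioo_subset_Icc_self hz2.2⟩
    refine ⟨?_, hz2'⟩
    rw [Function.mem_support, (hHval z hz2').1]
    exact (mul_pos (β.pos_of_mem_ball hz1)
      (mul_pos hww ((hHval z hz2').2 (Metric.ball_subset_closedBall hz1)))).ne'

/-- The weak equation gives the equation at the initial time as well. -/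
theorem IsChart.defect_eq_zero_of_mem_Ico (h : IsChart Ω Te ℓ τ Y J r U) (hTe : 0 < Te)
    (hα : ContinuousOn (fun p : E3 × E3 => αt p.1 p.2) (Metric.sphere 0 1 ×ˢ univ))
    (hT : ContinuousOn (fun p : ℝ × E3 => T p.1 p.2) (Icc 0 Te ×ˢ closure Ω)) (hb : b ≠ 0)
    (hweak : IsWeakSolution Ω Te αt T b (fun t => curveMeasure b (ℓ t)) τ) {t₁ s₁ : ℝ}
    (ht₁ : t₁ ∈ J) (htI : t₁ ∈ Ico 0 Te) (hs₁ : s₁ ∈ Icc (-r) r) (hU : Y (t₁, s₁) ∈ U) :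
    defect αt T b Y (t₁, s₁) = 0 := by
  set S : Set ℝ := {t | t ∈ J ∩ Ioo 0 Te ∧ Y (t, s₁) ∈ U} with hS
  have hcY : Continuous fun t : ℝ => Y (t, s₁) := h.contDiff.continuous.comp (by fun_prop)
  have hO : {t | t ∈ J ∧ Y (t, s₁) ∈ U} ∈ 𝓝 t₁ :=
    inter_mem (h.isOpen_time.mem_nhds ht₁) (hcY.continuousAt (h.isOpen_space.mem_nhds hU))
  -- Test fields see only positive times; t₁ = 0 is reached as a limit along fixed s₁.
  have hcl : t₁ ∈ closure S := by
    have h1 : t₁ ∈ closure (Ioo 0 Te) := by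
      rw [closure_Ioo hTe.ne]; exact Ico_subset_Icc_self htI
    rw [mem_closure_iff_nhds] at h1 ⊢
    intro V hV
    obtain ⟨t, ⟨htV, htO⟩, htJ⟩ := h1 _ (inter_mem hV hO)
    exact ⟨t, htV, ⟨htO.1, htJ⟩, htO.2⟩
  have hc : ContinuousWithinAt (fun t => defect αt T b Y (t, s₁)) S t₁ := by
    have hpair : Continuous fun t : ℝ => (t, s₁) := by fun_prop
    have hd : ContinuousWithinAt (fun t => drive αt T b Y (t, s₁)) S t₁ :=
      ContinuousWithinAt.comp (g := drive αt T b Y) (f := fun t : ℝ => (t, s₁)) (x := t₁)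
        ((h.continuousOn_drive hα hT) (t₁, s₁) ⟨⟨ht₁, Ico_subset_Icc_self htI⟩, hs₁, hU⟩)
        hpair.continuousWithinAt
        fun t ht => ⟨⟨ht.1.1, Ioo_subset_Icc_self ht.1.2⟩, hs₁, ht.2⟩
    have hv : ContinuousWithinAt (fun t => velocity Y (t, s₁)) S t₁ :=
      ((continuous_velocity h.contDiff).comp hpair).continuousWithinAt
    have hw : ContinuousWithinAt (fun t => tangent Y (t, s₁)) S t₁ :=
      ((continuous_tangent h.contDiff).comp hpair).continuousWithinAt
    exact (hv.sub hd).cross hw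
  have hz : ∀ t ∈ S, defect αt T b Y (t, s₁) = 0 := fun t ht =>
    h.defect_eq_zero hα hT hb hweak ht.1 hs₁ ht.2
  have := hc.mem_closure hcl (t := {0}) fun t ht => hz t ht
  simpa using this

end Necessity

/-! ### From the normal velocity to the weak equation -/

section Sufficiency

open scoped Manifold

/-- The weak equation `∂ₜ ρ = rot (α̃(τ, τ × Tb) × ρ)` tested with the single test field `φ`. -/
def IsWeakSolutionFor (Te : ℝ) (αt : E3 → E3 → E3) (T : ℝ → E3 → Matrix (Fin 3) (Fin 3) ℝ) (b : E3)
    (μ : ℝ → Measure E3) (τ : ℝ → E3 → E3) (φ : ℝ × E3 → E3) : Prop :=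
  HasTestIntegrals Te αt T b μ τ φ ∧
    - ∫ t in Ioo 0 Te, pairing (μ t) (τ t) (fun x => deriv (fun s => φ (s, x)) t) =
      ∫ t in Ioo 0 Te, pairing (μ t) (alphaDensity αt (T t) (τ t) b) (rot (fun x => φ (t, x)))

variable {αt : E3 → E3 → E3} {b : E3} {T : ℝ → E3 → Matrix (Fin 3) (Fin 3) ℝ}
  {Ω : Set E3} {Te : ℝ} {ℓ : ℝ → Set E3} {τ : ℝ → E3 → E3} {μ : ℝ → Measure E3}
  {Y : ℝ × ℝ → E3} {J : Set ℝ} {r : ℝ} {U : Set E3}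

theorem rot_slice_add {φ₁ φ₂ : ℝ × E3 → E3} (h₁ : ContDiff ℝ ∞ φ₁) (h₂ : ContDiff ℝ ∞ φ₂) (t : ℝ) :
    rot (fun x => (φ₁ + φ₂) (t, x)) = fun x =>
      rot (fun x => φ₁ (t, x)) x + rot (fun x => φ₂ (t, x)) x := by
  funext x
  have hf : fderiv ℝ (φ₁ + φ₂) (t, x) = fderiv ℝ φ₁ (t, x) + fderiv ℝ φ₂ (t, x) :=
    fderiv_add (h₁.differentiable (by simp) _) (h₂.differentiable (by simp) _)
  have hp : ∀ i j, partialDeriv (fun y => (φ₁ + φ₂) (t, y)) i j x =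
      partialDeriv (fun y => φ₁ (t, y)) i j x + partialDeriv (fun y => φ₂ (t, y)) i j x := by
    intro i j
    rw [partialDeriv_slice (φ := φ₁ + φ₂) (h₁.add h₂), partialDeriv_slice h₁, partialDeriv_slice h₂,
      hf]
    rfl
  simp only [rot, hp]
  apply E3.ext_coord <;> simp <;> ring

theorem deriv_slice_add {φ₁ φ₂ : ℝ × E3 → E3} (h₁ : ContDiff ℝ ∞ φ₁) (h₂ : ContDiff ℝ ∞ φ₂) (t : ℝ) :
    (fun x => deriv (fun s => (φ₁ + φ₂) (s, x)) t) = fun x =>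
      deriv (fun s => φ₁ (s, x)) t + deriv (fun s => φ₂ (s, x)) t := by
  funext x
  exact deriv_add (hasDerivAt_time h₁ t x).differentiableAt (hasDerivAt_time h₂ t x).differentiableAt

/-- Splitting the pairings requires integrability over the curve at each time, which is why
`HasTestIntegrals` records more than the existence of the time integrals. -/
theorem IsWeakSolutionFor.add {φ₁ φ₂ : ℝ × E3 → E3} (h₁ : ContDiff ℝ ∞ φ₁) (h₂ : ContDiff ℝ ∞ φ₂)
    (H₁ : IsWeakSolutionFor Te αt T b μ τ φ₁) (H₂ : IsWeakSolutionFor Te αt T b μ τ φ₂) :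
    IsWeakSolutionFor Te αt T b μ τ (φ₁ + φ₂) := by
  obtain ⟨⟨a1, a2, a3, a4⟩, a5⟩ := H₁
  obtain ⟨⟨b1, b2, b3, b4⟩, b5⟩ := H₂
  have hl : ∀ t ∈ Ioo 0 Te,
      pairing (μ t) (τ t) (fun x => deriv (fun s => φ₁ (s, x)) t) +
        pairing (μ t) (τ t) (fun x => deriv (fun s => φ₂ (s, x)) t) =
      pairing (μ t) (τ t) (fun x => deriv (fun s => (φ₁ + φ₂) (s, x)) t) := by
    intro t ht
    rw [deriv_slice_add h₁ h₂]
    simp only [pairing, inner_add_right]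
    exact (integral_add (a1 t ht) (b1 t ht)).symm
  have hr : ∀ t ∈ Ioo 0 Te,
      pairing (μ t) (alphaDensity αt (T t) (τ t) b) (rot (fun x => φ₁ (t, x))) +
        pairing (μ t) (alphaDensity αt (T t) (τ t) b) (rot (fun x => φ₂ (t, x))) =
      pairing (μ t) (alphaDensity αt (T t) (τ t) b) (rot (fun x => (φ₁ + φ₂) (t, x))) := by
    intro t ht
    rw [rot_slice_add h₁ h₂]
    simp only [pairing, inner_add_right]
    exact (integral_add (a2 t ht) (b2 t ht)).symm
  refine ⟨⟨fun t ht => ?_, fun t ht => ?_, ?_, ?_⟩, ?_⟩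
  · have e := deriv_slice_add h₁ h₂ t
    refine ((a1 t ht).add (b1 t ht)).congr (Eventually.of_forall fun x => ?_)
    change _ = inner ℝ (τ t x) ((fun x => deriv (fun s => (φ₁ + φ₂) (s, x)) t) x)
    rw [e, inner_add_right]
    rfl
  · rw [rot_slice_add h₁ h₂]
    simp only [inner_add_right]
    exact (a2 t ht).add (b2 t ht)
  · exact (a3.add b3).congr_fun hl measurableSet_Ioo
  · exact (a4.add b4).congr_fun hr measurableSet_Ioo
  · rw [← setIntegral_congr_fun measurableSet_Ioo hl, ← setIntegral_congr_fun measurableSet_Ioo hr,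
      integral_add a3 b3, integral_add a4 b4, ← a5, ← b5, neg_add]

theorem IsWeakSolutionFor.of_ae_eq_zero {φ : ℝ × E3 → E3}
    (hl : ∀ t ∈ Ioo 0 Te, (fun x => (inner ℝ (τ t x) (deriv (fun s => φ (s, x)) t) : ℝ)) =ᵐ[μ t] 0)
    (hr : ∀ t ∈ Ioo 0 Te, (fun x => (inner ℝ (alphaDensity αt (T t) (τ t) b x)
      (rot (fun x => φ (t, x)) x) : ℝ)) =ᵐ[μ t] 0) :
    IsWeakSolutionFor Te αt T b μ τ φ := by
  have hl' : ∀ t ∈ Ioo 0 Te, (0 : ℝ) = pairing (μ t) (τ t) (fun x => deriv (fun s => φ (s, x)) t) :=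
    fun t ht => (integral_eq_zero_of_ae (hl t ht)).symm
  have hr' : ∀ t ∈ Ioo 0 Te,
      (0 : ℝ) = pairing (μ t) (alphaDensity αt (T t) (τ t) b) (rot (fun x => φ (t, x))) :=
    fun t ht => (integral_eq_zero_of_ae (hr t ht)).symm
  have h0 : IntegrableOn (fun _ : ℝ => (0 : ℝ)) (Ioo 0 Te) := integrableOn_zero
  refine ⟨⟨fun t ht => (integrable_congr (hl t ht)).2 (integrable_zero _ _ _),
    fun t ht => (integrable_congr (hr t ht)).2 (integrable_zero _ _ _),
    h0.congr_fun hl' measurableSet_Ioo, h0.congr_fun hr' measurableSet_Ioo⟩, ?_⟩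
  rw [← setIntegral_congr_fun measurableSet_Ioo hl', ← setIntegral_congr_fun measurableSet_Ioo hr']
  simp

theorem isWeakSolutionFor_sum {ι : Type*} (I : Finset ι) {f : ι → ℝ × E3 → E3}
    (hf : ∀ i ∈ I, ContDiff ℝ ∞ (f i))
    (H : ∀ i ∈ I, IsWeakSolutionFor Te αt T b μ τ (f i)) :
    IsWeakSolutionFor Te αt T b μ τ (∑ i ∈ I, f i) := by
  classical
  induction I using Finset.induction_on with
  | empty =>
    refine IsWeakSolutionFor.of_ae_eq_zero (fun t _ => ?_) fun t _ => ?_ <;>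
    refine Eventually.of_forall fun x => ?_
    · simp
    · have h0 : ContDiff ℝ ∞ (∑ i ∈ (∅ : Finset ι), f i) := by
        rw [Finset.sum_empty]; exact contDiff_const
      have : ((t, x) : ℝ × E3) ∉ tsupport (∑ i ∈ (∅ : Finset ι), f i) := by
        simp [tsupport]
      simp only [rot_slice_eq_zero h0 this, inner_zero_right, Pi.zero_apply]
  | insert i I hi ih =>
    rw [Finset.sum_insert hi]
    refine (H i (Finset.mem_insert_self i I)).add (hf i (Finset.mem_insert_self i I)) ?_
      (ih (fun j hj => hf j (Finset.mem_insert_of_mem hj))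
        fun j hj => H j (Finset.mem_insert_of_mem hj))
    rw [Finset.sum_fn]
    exact ContDiff.sum fun j hj => hf j (Finset.mem_insert_of_mem hj)

/-- Test fields the support of which does not meet the curve satisfy the weak equation. -/
theorem isWeakSolutionFor_of_disjoint {φ : ℝ × E3 → E3} (hφ : ContDiff ℝ ∞ φ)
    (hdisj : ∀ t ∈ Ioo 0 Te, ∀ x ∈ ℓ t, (t, x) ∉ tsupport φ) :
    IsWeakSolutionFor Te αt T b (fun t => curveMeasure b (ℓ t)) τ φ := by
  have key : ∀ t ∈ Ioo 0 Te, ∀ f : E3 → ℝ, (∀ x, (t, x) ∉ tsupport φ → f x = 0) →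
      f =ᵐ[curveMeasure b (ℓ t)] 0 := by
    intro t ht f hf
    have hD : IsClosed {x : E3 | (t, x) ∈ tsupport φ} :=
      (isClosed_tsupport φ).preimage (by fun_prop)
    have h0 : curveMeasure b (ℓ t) {x : E3 | (t, x) ∈ tsupport φ} = 0 := by
      have he : {x : E3 | (t, x) ∈ tsupport φ} ∩ ℓ t = ∅ :=
        eq_empty_of_forall_notMem fun x hx => hdisj t ht x hx.2 hx.1
      rw [curveMeasure, Measure.smul_apply, Measure.restrict_apply hD.measurableSet, he]
      simp
    filter_upwards [measure_eq_zero_iff_ae_notMem.1 h0] with x hx using hf x hx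
  refine IsWeakSolutionFor.of_ae_eq_zero (fun t ht => key t ht _ fun x hx => ?_)
    fun t ht => key t ht _ fun x hx => ?_
  · rw [(hasDerivAt_time hφ t x).deriv, fderiv_eq_zero_of_notMem_tsupport hx]; simp
  · rw [rot_slice_eq_zero hφ hx, inner_zero_right]

theorem IsChart.isWeakSolutionFor (h : IsChart Ω Te ℓ τ Y J r U)
    (hα : ContinuousOn (fun p : E3 × E3 => αt p.1 p.2) (Metric.sphere 0 1 ×ˢ univ))
    (hT : ContinuousOn (fun p : ℝ × E3 => T p.1 p.2) (Icc 0 Te ×ˢ closure Ω))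
    (hd : ∀ t ∈ J ∩ Ioo 0 Te, ∀ s ∈ Icc (-r) r, Y (t, s) ∈ U → defect αt T b Y (t, s) = 0)
    {φ : ℝ × E3 → E3} (hφ : ContDiff ℝ ∞ φ) (hφc : HasCompactSupport φ)
    (hφs : tsupport φ ⊆ (J ∩ Ioo 0 Te) ×ˢ U) :
    IsWeakSolutionFor Te αt T b (fun t => curveMeasure b (ℓ t)) τ φ := by
  obtain ⟨hi, -, hres⟩ := h.weak_residual hα hT b hφ hφc hφs
  refine ⟨hi, ?_⟩
  have h0 : ∫ z in Ioo 0 Te ×ˢ Icc (-r) r,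
      inner ℝ (rot (fun x => φ (z.1, x)) (Y z)) (defect αt T b Y z) = 0 := by
    refine setIntegral_eq_zero_of_forall_eq_zero fun z hz => ?_
    by_cases hk : (z.1, Y z) ∈ tsupport φ
    · have : defect αt T b Y z = 0 := hd z.1 (hφs hk).1 z.2 hz.2 (hφs hk).2
      rw [this, inner_zero_right]
    · rw [rot_slice_eq_zero hφ hk, inner_zero_left]
  rw [h0] at hres
  linarith

/-- The weak equation is additive in the test field, so a partition of unity on the compact support
reduces it to fields that live in one chart or avoid the curve. -/
theorem isWeakSolution_of_forall_defect_eq_zero (hΩ : IsOpen Ω) (hℓ : IsMovingCurve Ω Te ℓ τ)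
    (hα : ContinuousOn (fun p : E3 × E3 => αt p.1 p.2) (Metric.sphere 0 1 ×ˢ univ))
    (hT : ContinuousOn (fun p : ℝ × E3 => T p.1 p.2) (Icc 0 Te ×ˢ closure Ω))
    (hd : ∀ Y J r U, IsChart Ω Te ℓ τ Y J r U →
      ∀ t ∈ J ∩ Ioo 0 Te, ∀ s ∈ Icc (-r) r, Y (t, s) ∈ U → defect αt T b Y (t, s) = 0) :
    IsWeakSolution Ω Te αt T b (fun t => curveMeasure b (ℓ t)) τ := by
  intro φ hφ hφc hφs
  have hloc : ∀ p ∈ tsupport φ, ∃ V, IsOpen V ∧ p ∈ V ∧ ∀ χ : ℝ × E3 → E3, ContDiff ℝ ∞ χ →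
      HasCompactSupport χ → tsupport χ ⊆ V →
      IsWeakSolutionFor Te αt T b (fun t => curveMeasure b (ℓ t)) τ χ := by
    rintro ⟨t₀, x₀⟩ hp
    have hpI := hφs hp
    by_cases hx : x₀ ∈ ℓ t₀
    · obtain ⟨Y, J, r, U, h, -, htJ, hxU, -⟩ :=
        hℓ.exists_isChart hΩ (Ioo_subset_Ico_self hpI.1) hx
      exact ⟨(J ∩ Ioo 0 Te) ×ˢ U, (h.isOpen_time.inter isOpen_Ioo).prod h.isOpen_space,
        ⟨⟨htJ, hpI.1⟩, hxU⟩,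
        fun χ hχ hχc hχs => h.isWeakSolutionFor hα hT (hd Y J r U h) hχ hχc hχs⟩
    -- Relative closedness of the space-time track provides a neighbourhood of the point free of the
    -- curve.
    · refine ⟨(closure {p : ℝ × E3 | p.1 ∈ Ico 0 Te ∧ p.2 ∈ ℓ p.1})ᶜ, isClosed_closure.isOpen_compl,
        fun hcl => hx (hℓ.relClosed ⟨hcl, Ioo_subset_Ico_self hpI.1, hpI.2⟩).2,
        fun χ hχ _ hχs => isWeakSolutionFor_of_disjoint hχ fun t ht x hxt hk => hχs hk ?_⟩
      exact subset_closure ⟨Ioo_subset_Ico_self ht, hxt⟩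
  choose! V hVo hpV hV using hloc
  obtain ⟨I, hI, hcover⟩ := hφc.isCompact.elim_nhds_subcover V
    fun p hp => (hVo p hp).mem_nhds (hpV p hp)
  obtain ⟨f, hf⟩ := SmoothPartitionOfUnity.exists_isSubordinate 𝓘(ℝ, ℝ × E3)
    (isClosed_tsupport φ) (fun i : I => V i) (fun i => hVo i (hI i i.2))
    (hcover.trans (iUnion₂_subset fun i hi => subset_iUnion (fun i : I => V i) ⟨i, hi⟩))
  have hfd : ∀ i, ContDiff ℝ ∞ (f i) := fun i => (f i).contMDiff.contDiff
  -- The cut-offs sum to 1 only on the support of φ; elsewhere both sides vanish.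
  have hsum : φ = ∑ i : I, fun p => f i p • φ p := by
    funext p
    rw [Finset.sum_apply, ← Finset.sum_smul]
    by_cases hp : p ∈ tsupport φ
    · have := f.sum_eq_one hp
      rw [finsum_eq_sum_of_fintype] at this
      rw [this, one_smul]
    · rw [image_eq_zero_of_notMem_tsupport hp, smul_zero]
  have key : IsWeakSolutionFor Te αt T b (fun t => curveMeasure b (ℓ t)) τ φ := by
    rw [hsum]
    refine isWeakSolutionFor_sum _ (fun i _ => (hfd i).smul hφ) fun i _ => ?_
    refine hV i (hI i i.2) _ ((hfd i).smul hφ) (hφc.smul_left (f := f i)) ?_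
    exact (tsupport_smul_subset_left (f i) φ).trans (hf i)
  exact ⟨key.1.integrableOn_left, key.1.integrableOn_right, key.2⟩

theorem isWeakSolution_iff_hasNormalVelocity (hΩ : IsOpen Ω) (hTe : 0 < Te) (hb : b ≠ 0)
    (hℓ : IsMovingCurve Ω Te ℓ τ)
    (hα : ContinuousOn (fun p : E3 × E3 => αt p.1 p.2) (Metric.sphere 0 1 ×ˢ univ))
    (hT : ContinuousOn (fun p : ℝ × E3 => T p.1 p.2) (Icc 0 Te ×ˢ closure Ω)) :
    IsWeakSolution Ω Te αt T b (fun t => curveMeasure b (ℓ t)) τ ↔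
      ∀ t ∈ Ico 0 Te, ∀ x ∈ ℓ t,
        HasNormalVelocity Te ℓ τ t x
          (projPerp (τ t x) (αt (τ t x) (cross (τ t x) (app (T t x) b)))) := by
  have hdrive : ∀ {Y J r U}, IsChart Ω Te ℓ τ Y J r U → ∀ {t s}, t ∈ J ∩ Ico 0 Te →
      s ∈ Icc (-r) r → Y (t, s) ∈ U →
      αt (τ t (Y (t, s))) (cross (τ t (Y (t, s))) (app (T t (Y (t, s))) b)) =
        drive αt T b Y (t, s) := by
    intro Y J r U h t s ht hs hU
    rw [h.tangent_eq t ht s hs hU]; rfl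
  constructor
  · intro hweak t ht x hx
    obtain ⟨Y, J, r, U, h, hr, htJ, hxU, rfl⟩ := hℓ.exists_isChart hΩ ht hx
    have h0 : (0 : ℝ) ∈ Icc (-r) r := ⟨by linarith, hr.le⟩
    rw [hdrive h ⟨htJ, ht⟩ h0 hxU, h.hasNormalVelocity_projPerp_iff htJ ht h0 hxU]
    exact h.defect_eq_zero_of_mem_Ico hTe hα hT hb hweak htJ ht h0 hxU
  · intro hv
    refine isWeakSolution_of_forall_defect_eq_zero hΩ hℓ hα hT fun Y J r U h t ht s hs hU => ?_
    have htI := Ioo_subset_Ico_self ht.2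
    have := hv t htI _ (h.mem_curve ht.1 htI hs hU)
    rwa [hdrive h ⟨ht.1, htI⟩ hs hU, h.hasNormalVelocity_projPerp_iff ht.1 htI hs hU] at this

end Sufficiency

end Dislocation

theorem theorem3p3 (αt : E3 → E3 → E3)
    (hα : ContinuousOn (fun p : E3 × E3 => αt p.1 p.2) (Metric.sphere 0 1 ×ˢ univ))
    (b : E3) (hb : b ≠ 0) :
    -- (i) the dissipation inequality, at points `(T, ρ)` and for dislocation measures
    ((∀ τ ∈ Metric.sphere (0 : E3) 1, ∀ ξ : E3, 0 ≤ inner ℝ ξ (αt τ ξ)) →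
      (∀ (T : Matrix (Fin 3) (Fin 3) ℝ) (ρ : E3), T.IsSymm →
        0 ≤ inner ℝ (app T (‖b‖⁻¹ • b)) (alphaPoint αt T ρ b)) ∧
      (∀ (Ω : Set E3) (T : E3 → Matrix (Fin 3) (Fin 3) ℝ) (μ : Measure E3) (τ : E3 → E3),
        IsOpen Ω → ContinuousOn T (closure Ω) → (∀ x ∈ closure Ω, (T x).IsSymm) →
        IsDislocationMeasure Ω μ τ →
        ∀ ψ : E3 → ℝ, Continuous ψ → HasCompactSupport ψ → tsupport ψ ⊆ Ω → (∀ x, 0 ≤ ψ x) →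
          0 ≤ pairing μ (alphaDensity αt T τ b) (fun x => ψ x • app (T x) (‖b‖⁻¹ • b)))) ∧
    -- (ii) the evolution equation and the normal velocity
    (∀ (Ω : Set E3) (Te : ℝ) (T : ℝ → E3 → Matrix (Fin 3) (Fin 3) ℝ)
        (ℓ : ℝ → Set E3) (τ : ℝ → E3 → E3),
      IsOpen Ω → 0 < Te →
      ContinuousOn (fun p : ℝ × E3 => T p.1 p.2) (Icc 0 Te ×ˢ closure Ω) →
      (∀ t ∈ Icc 0 Te, ∀ x ∈ closure Ω, (T t x).IsSymm) →
      IsMovingCurve Ω Te ℓ τ →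
      (∀ t ∈ Ico 0 Te, IsDislocationMeasure Ω (curveMeasure b (ℓ t)) (τ t)) →
      (IsWeakSolution Ω Te αt T b (fun t => curveMeasure b (ℓ t)) τ ↔
        ∀ t ∈ Ico 0 Te, ∀ x ∈ ℓ t,
          HasNormalVelocity Te ℓ τ t x
            (projPerp (τ t x) (αt (τ t x) (cross (τ t x) (app (T t x) b)))))) := by
  refine ⟨fun h => ⟨fun A ρ _ => inner_app_alphaPoint_nonneg h A b ρ,
    fun Ω T μ τ _ _ _ hμ ψ _ _ _ hψ => pairing_alphaDensity_nonneg h T b hμ hψ⟩,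
    fun Ω Te T ℓ τ hΩ hTe hT _ hℓ _ => isWeakSolution_iff_hasNormalVelocity hΩ hTe hb hℓ hα hT⟩
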